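/- An episodic preference-based MDP (PbMDP) with Borda scores consists of a finite state space $\mathcal S$ with $S$ elements, an action space $[K]\times[K]$ (ordered pairs of $K$ arms), a layering $\mathcal S=\bigsqcup_{h=0}^{H}\mathcal S_h$ into nonempty layers with $\mathcal S_0=\{s_0\}$ and $\mathcal S_H=\{s_H\}$, a transition kernel $P(\cdot\mid s,a)$ that is supported on $\mathcal S_{h+1}$ whenever $s\in\mathcal S_h$ and $h<H$, and preference functions $\mathbb P_1,\dots,\mathbb P_T:\mathcal S\times[K]\times[K]\to[0,1]$ with $\mathbb P_t(s,i,j)=1-\mathbb P_t(s,j,i)$. The losses are $\ell_t(s,(i,j))=-\frac12\big(b_t(s,i)+b_t(s,j)\big)$, where $b_t(s,i)=\frac1K\sum_{j=1}^K\big(\mathbb P_t(s,i,j)-1\big)$ is the shifted Borda score. In each episode $t=1,\dots,T$ the learner, who may know $\mathcal S$, its layers and $P$ and may randomize, selects a (possibly non-Markovian) policy $\pi_t$ from the observations of the previous episodes and executes it from $s_0$ for $H$ steps; in step $h$, in state $s_{t,h}$, it plays $(a^L,a^R)$ and observes only the next state and a feedback drawn from $\mathrm{Ber}\big(\mathbb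 P_t(s_{t,h},a^L,a^R)\big)$. With $V^{\pi}(s_0;\ell)$ the expected total loss of an episode under $\pi$, the regret is $$\mathsf{Reg}_T=\sum_{t=1}^T V^{\pi_t}(s_0;\ell_t)-\min_{\pi}\sum_{t=1}^T V^{\pi}(s_0;\ell_t),$$ the minimum being over all stochastic Markov policies. **Theorem.** There is an absolute constant $c>0$ such that for all integers $H\ge 3$, $K\ge 5$, $S\ge H+1$ and $T\ge SK/H$ and for every learner, there is an episodic PbMDP with Borda scores with $H$ steps, $S$ states, $K$ arms and $T$ episodes for which $$\mathbb E[\mathsf{Reg}_T]\ \ge\ c\,(H^2SK)^{1/3}\,T^{2/3}.$$ -/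

import Mathlib

open MeasureTheory

noncomputable section

namespace PbMDP

/-- An action is an ordered pair of arms `(a^L, a^R)`; there are `K` arms. -/
abbrev Action (K : ℕ) : Type := Fin K × Fin K

/-- A tabular MDP with `H` steps per episode, action space `[K] × [K]` and finite state space `𝓢`,
whose states are split into `H + 1` nonempty layers; the first and the last layer are singletons and
every transition from a non-terminal state goes to the next layer. `transition s a` is the
distribution `P(· ∣ s, a)` on `𝓢`. -/
structure LayeredMDP (H K : ℕ) (𝓢 : Type) [Fintype 𝓢] where
  layer : 𝓢 → Fin (H + 1)
  layer_surjective : Function.Surjective layer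
  initial : 𝓢
  terminal : 𝓢
  layer_initial : ∀ s, layer s = 0 ↔ s = initial
  layer_terminal : ∀ s, layer s = Fin.last H ↔ s = terminal
  transition : 𝓢 → Action K → stdSimplex ℝ 𝓢
  forward : ∀ s a s', (layer s : ℕ) < H → (layer s' : ℕ) ≠ (layer s : ℕ) + 1 →
    transition s a s' = 0

/-- A preference function: `pr s (i, j) ∈ [0, 1]` is the probability that arm `i` beats arm `j`
in state `s`. -/
structure Preference (K : ℕ) (𝓢 : Type) where
  pr : 𝓢 → Action K → ℝ
  mem_Icc : ∀ s a, pr s a ∈ Set.Icc (0 : ℝ) 1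
  skew : ∀ s i j, pr s (i, j) = 1 - pr s (j, i)

/-- The shifted Borda score `b(s, i) = (1 / K) ∑_j (ℙ(s, i, j) - 1)`. -/
def Preference.borda {K : ℕ} {𝓢 : Type} (p : Preference K 𝓢) (s : 𝓢) (i : Fin K) : ℝ :=
  (1 / (K : ℝ)) * ∑ j : Fin K, (p.pr s (i, j) - 1)

/-- The Borda loss `ℓ(s, a) = - (b(s, a^L) + b(s, a^R)) / 2`. -/
def Preference.loss {K : ℕ} {𝓢 : Type} (p : Preference K 𝓢) (s : 𝓢) (a : Action K) : ℝ :=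
  -(1 / 2) * (p.borda s a.1 + p.borda s a.2)

/-- What the learner sees in one step: the state, the arm pair it plays, and the binary preference
feedback (`true` if the left arm wins). -/
structure Step (K : ℕ) (𝓢 : Type) where
  state : 𝓢
  action : Action K
  feedback : Bool

/-- Steps are triples. -/
def Step.equivProd (K : ℕ) (𝓢 : Type) : 𝓢 × Action K × Bool ≃ Step K 𝓢 where
  toFun x := ⟨x.1, x.2.1, x.2.2⟩
  invFun x := (x.state, x.action, x.feedback)
  left_inv _ := rfl
  right_inv _ := rfl

instance Step.instFintype (K : ℕ) (𝓢 : Type) [Fintype 𝓢] : Fintype (Step K 𝓢) :=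
  Fintype.ofEquiv _ (Step.equivProd K 𝓢)

/-- The trajectory of one episode. -/
abbrev Trajectory (H K : ℕ) (𝓢 : Type) : Type := Fin H → Step K 𝓢

/-- The policy of one episode, possibly non-Markovian: the distribution of the action of step `h`
may depend on everything seen in the previous steps of the episode and on the current state. -/
abbrev EpisodePolicy (H K : ℕ) (𝓢 : Type) : Type :=
  (h : Fin H) → (Fin h → Step K 𝓢) → 𝓢 → stdSimplex ℝ (Action K)

/-- A stochastic Markov policy, an element of `Δ(𝓐)^𝓢`. -/
abbrev MarkovPolicy (K : ℕ) (𝓢 : Type) : Type := 𝓢 → stdSimplex ℝ (Action K)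

/-- A Markov policy seen as the policy of an episode. -/
def MarkovPolicy.toEpisodePolicy {K : ℕ} {𝓢 : Type} (H : ℕ) (π : MarkovPolicy K 𝓢) :
    EpisodePolicy H K 𝓢 := fun _ _ s => π s

/-- The Bernoulli distribution with mean `p`. -/
def bernoulliWeight (p : ℝ) (o : Bool) : ℝ := if o then p else 1 - p

open Classical in
/-- The probability of entering the state of step `h` of the trajectory `τ`, given the
previous step: episodes start in the initial state and then follow the transition kernel. -/
def LayeredMDP.arrivalProb {H K : ℕ} {𝓢 : Type} [Fintype 𝓢] (M : LayeredMDP H K 𝓢)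
    (τ : Trajectory H K 𝓢) (h : Fin H) : ℝ :=
  if (h : ℕ) = 0 then (if (τ h).state = M.initial then 1 else 0)
  else
    let prev : Step K 𝓢 := τ ⟨(h : ℕ) - 1, lt_of_le_of_lt (Nat.sub_le _ _) h.isLt⟩
    M.transition prev.state prev.action (τ h).state

/-- The probability of the trajectory `τ` when the policy `π` is executed in the MDP `M` under the
preference function `p`: in each step, the state is entered, an action is drawn from `π`, and the
feedback is Bernoulli with the mean that `p` gives to the state and the action. -/
def LayeredMDP.trajectoryProb {H K : ℕ} {𝓢 : Type} [Fintype 𝓢] (M : LayeredMDP H K 𝓢)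
    (p : Preference K 𝓢) (π : EpisodePolicy H K 𝓢) (τ : Trajectory H K 𝓢) : ℝ :=
  ∏ h : Fin H,
    (M.arrivalProb τ h
      * π h (fun i => τ (Fin.castLE h.isLt.le i)) (τ h).state (τ h).action
      * bernoulliWeight (p.pr (τ h).state (τ h).action) (τ h).feedback)

/-- The value `V^π(s₀; ℓ)`: the expected total loss `∑_{h < H} ℓ(s_h, a_h)` of an episode. -/
def LayeredMDP.value {H K : ℕ} {𝓢 : Type} [Fintype 𝓢] (M : LayeredMDP H K 𝓢)
    (p : Preference K 𝓢) (ℓ : 𝓢 → Action K → ℝ) (π : EpisodePolicy H K 𝓢) : ℝ :=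
  ∑ τ : Trajectory H K 𝓢,
    M.trajectoryProb p π τ * ∑ h : Fin H, ℓ (τ h).state (τ h).action

/-- A learner that knows the MDP (states, layers, transition kernel) but not the preferences, with
internal randomness `ω ∈ Ω`: before episode `t` it selects the policy of the episode from
the trajectories (with feedback) of the episodes before `t`. Learners that do not
know the MDP are those that ignore the first argument of `policy`. -/
structure Learner (H K : ℕ) (𝓢 : Type) [Fintype 𝓢] (Ω : Type*) [MeasurableSpace Ω] where
  policy : LayeredMDP H K 𝓢 → (t : ℕ) → (Fin t → Trajectory H K 𝓢) → Ω → EpisodePolicy H K 𝓢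
  measurable_policy : ∀ M t past h hist s, Measurable fun ω => policy M t past ω h hist s

/-- An episodic preference-based MDP with `T` episodes: a layered MDP and a preference function for
each episode. Its losses are the Borda losses of the preference functions. -/
structure Instance (H K T : ℕ) (𝓢 : Type) [Fintype 𝓢] where
  mdp : LayeredMDP H K 𝓢
  pref : Fin T → Preference K 𝓢

section Interaction

variable {H K T : ℕ} {𝓢 : Type} [Fintype 𝓢] {Ω : Type*} [MeasurableSpace Ω]

/-- The policy `π_t` that the learner with internal randomness `ω` selects for episode `t` when the
trajectories of the episodes are `τ`; it only depends on those before `t`. -/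
def Instance.policyAt (I : Instance H K T 𝓢) (L : Learner H K 𝓢 Ω) (ω : Ω)
    (τ : Fin T → Trajectory H K 𝓢) (t : Fin T) : EpisodePolicy H K 𝓢 :=
  L.policy I.mdp t (fun i => τ (Fin.castLE t.isLt.le i)) ω

/-- The probability, given the internal randomness `ω`, that the trajectories of the `T` episodes
are `τ`. -/
def Instance.interactionProb (I : Instance H K T 𝓢) (L : Learner H K 𝓢 Ω) (ω : Ω)
    (τ : Fin T → Trajectory H K 𝓢) : ℝ :=
  ∏ t : Fin T, I.mdp.trajectoryProb (I.pref t) (I.policyAt L ω τ t) (τ t)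

/-- `∑_t V^π(s₀; ℓ_t)` for a fixed Markov policy `π`. -/
def Instance.markovLoss (I : Instance H K T 𝓢) (π : MarkovPolicy K 𝓢) : ℝ :=
  ∑ t : Fin T, I.mdp.value (I.pref t) (I.pref t).loss (π.toEpisodePolicy H)

/-- The regret `Reg_T = ∑_t V^{π_t}(s₀; ℓ_t) - min_π ∑_t V^π(s₀; ℓ_t)`, the minimum being over all
stochastic Markov policies. -/
def Instance.regret (I : Instance H K T 𝓢) (L : Learner H K 𝓢 Ω) (ω : Ω)
    (τ : Fin T → Trajectory H K 𝓢) : ℝ :=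
  ∑ t : Fin T, I.mdp.value (I.pref t) (I.pref t).loss (I.policyAt L ω τ t)
    - ⨅ π : MarkovPolicy K 𝓢, I.markovLoss π

/-- The expected regret `𝔼[Reg_T]`, over the internal randomness of the learner (with law `μ`) and
over the trajectories of the `T` episodes. -/
def Instance.expectedRegret (I : Instance H K T 𝓢) (L : Learner H K 𝓢 Ω) (μ : Measure Ω) : ℝ :=
  ∫ ω, (∑ τ : Fin T → Trajectory H K 𝓢, I.interactionProb L ω τ * I.regret L ω τ) ∂μ

end Interaction

end PbMDP

end

set_option linter.unusedSectionVars false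

/-! Split the arms into a good and a bad half. A good arm beats a bad one with probability `3 / 4`,
and arms of the same half are on a par. In each state at most one good arm is special: its winning
probability against bad arms is larger by `ε`. This raises its Borda score by a constant multiple of
`ε`, but it shows only in the feedback of pairs with a bad arm, and any such pair costs at least `1
/ 8` more than the best pair. Exploration is therefore paid at a constant rate, which is why `T ^ (2
/ 3)` replaces `T ^ (1 / 2)`.

The transitions ignore the actions and are uniform on the next layer, so the states are independent
with a known law `q` and the regret splits over steps and states. Fix a state `s` of layer `h`, and
let `x` be the expected number of episodes in which a bad arm would be played there. Against the
null environment, where no good arm is special, the regret in `s` is at least `x / 8`. The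
information about all good candidates together is at most of order `ε ^ 2 * q h s * x`. If this is
small compared with `K`, the special arm is missed for most candidates, at a cost of order `ε * T`.
The best arm is drawn uniformly from all `K` arms, a bad draw giving the null environment, so a
single prior contains both cases. When `ε ^ 3 * T * q h s` is at most of order `K`, the exploration
cost absorbs the information term and order `ε * T` remains (`le_sum_totalGap_update`).

Balanced layers have `q h s` of order at most `H / S`, which permits `ε` of order `(S * K / (H * T))
^ (1 / 3)`. Summing over steps gives `H * T * ε`, the claimed rate. The change of measure is
`expectedActionMean_le_add_kl`; averaging over the best arms is done by `le_sum_totalGap` and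
`exists_le_expectedRegret`. -/

noncomputable section

/-! ### Sequential sampling and change of measure on finite types -/

namespace SequentialProcess

variable {X : Type*}

/-- The first `n` entries of a finite sequence. -/
abbrev past {N : ℕ} (τ : Fin N → X) (n : Fin N) : Fin n → X :=
  fun i => τ (Fin.castLE n.isLt.le i)

/-- The weight of a sequence whose entries are drawn from the kernels `κ`, each of which depends on
the preceding entries. -/
def weight {N : ℕ} (κ : (n : Fin N) → (Fin n → X) → X → ℝ) (τ : Fin N → X) : ℝ :=
  ∏ n, κ n (past τ n) (τ n)

theorem past_snoc_castSucc {N : ℕ} (σ : Fin N → X) (x : X) (n : Fin N) :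
    past (Fin.snoc σ x : Fin (N + 1) → X) n.castSucc = past σ n := by
  funext i
  exact Fin.snoc_castSucc (α := fun _ => X) x σ (Fin.castLE n.isLt.le i)

theorem past_snoc_last {N : ℕ} (σ : Fin N → X) (x : X) :
    past (Fin.snoc σ x : Fin (N + 1) → X) (Fin.last N) = σ := by
  funext i
  exact Fin.snoc_castSucc (α := fun _ => X) x σ i

theorem weight_snoc {N : ℕ} (κ : (n : Fin (N + 1)) → (Fin n → X) → X → ℝ)
    (σ : Fin N → X) (x : X) :
    weight κ (Fin.snoc σ x : Fin (N + 1) → X)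
      = weight (fun n => κ n.castSucc) σ * κ (Fin.last N) σ x := by
  rw [weight, Fin.prod_univ_castSucc, weight]
  congr 1
  · refine Finset.prod_congr rfl fun n _ => ?_
    rw [past_snoc_castSucc, Fin.snoc_castSucc (α := fun _ => X)]
  · rw [past_snoc_last, Fin.snoc_last]

theorem sum_snoc [Fintype X] {N : ℕ} (F : (Fin (N + 1) → X) → ℝ) :
    ∑ τ, F τ = ∑ σ : Fin N → X, ∑ x, F (Fin.snoc σ x) := by
  rw [← (Fin.snocEquiv fun _ : Fin (N + 1) => X).sum_comp, Fintype.sum_prod_type_right]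
  rfl

theorem sum_weight [Fintype X] {N : ℕ} (κ : (n : Fin N) → (Fin n → X) → X → ℝ)
    (hκ : ∀ n p, ∑ x, κ n p x = 1) : ∑ τ, weight κ τ = 1 := by
  induction N with
  | zero => simp [weight]
  | succ N ih =>
    rw [sum_snoc]
    simp_rw [weight_snoc, ← Finset.mul_sum, hκ (Fin.last N), mul_one]
    exact ih _ fun n => hκ n.castSucc

/-- The tower property: the entry of index `n` may be replaced by an independent draw from its
kernel. -/
theorem sum_weight_mul [Fintype X] {N : ℕ} (κ : (n : Fin N) → (Fin n → X) → X → ℝ)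
    (hκ : ∀ n p, ∑ x, κ n p x = 1) (n : Fin N) (f : (Fin n → X) → X → ℝ) :
    ∑ τ, weight κ τ * f (past τ n) (τ n)
      = ∑ τ, weight κ τ * ∑ x, κ n (past τ n) x * f (past τ n) x := by
  induction N with
  | zero => exact n.elim0
  | succ N ih =>
    rw [sum_snoc, sum_snoc]
    simp_rw [weight_snoc]
    induction n using Fin.lastCases with
    | last =>
      refine Finset.sum_congr rfl fun σ _ => ?_
      simp_rw [past_snoc_last, Fin.snoc_last]
      rw [← Finset.sum_mul, ← Finset.mul_sum, hκ, mul_one, Finset.mul_sum]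
      exact Finset.sum_congr rfl fun x _ => mul_assoc _ _ _
    -- For an earlier entry the last kernel sums out to one.
    | cast n =>
      simp_rw [past_snoc_castSucc, Fin.snoc_castSucc (α := fun _ => X)]
      have h : ∀ (σ : Fin N → X) (r : ℝ), ∑ x, weight (fun n => κ n.castSucc) σ
          * κ (Fin.last N) σ x * r = weight (fun n => κ n.castSucc) σ * r := fun σ r => by
        rw [← Finset.sum_mul, ← Finset.mul_sum, hκ, mul_one]
      simp_rw [h]
      exact ih (fun n => κ n.castSucc) (fun n => hκ n.castSucc) n f

end SequentialProcess

/-- Change of measure: the means of a `[0, 1]`-valued function under two mutually absolutely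
continuous distributions on a finite type differ by little when the Kullback–Leibler divergence is
small. -/
theorem sum_mul_le_sum_mul_add_kl {X : Type*} [Fintype X] {A B₀ B₁ Y : X → ℝ}
    (hA : ∀ x, 0 ≤ A x) (hB₀ : ∀ x, 0 < B₀ x) (hB₁ : ∀ x, 0 < B₁ x)
    (h₀ : ∑ x, A x * B₀ x = 1) (h₁ : ∑ x, A x * B₁ x = 1)
    (hY₀ : ∀ x, 0 ≤ Y x) (hY₁ : ∀ x, Y x ≤ 1) {η : ℝ} (hη : 0 < η) :
    ∑ x, A x * B₁ x * Y x ≤ ∑ x, A x * B₀ x * Y x + 2 * η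
      + (∑ x, A x * B₀ x * (Real.log (B₀ x) - Real.log (B₁ x))) / (2 * η) := by
  have key : ∀ x, A x * B₁ x * Y x ≤ A x * B₀ x * Y x + η * (A x * B₀ x + A x * B₁ x)
      + (A x * B₁ x - A x * B₀ x
        + A x * B₀ x * (Real.log (B₀ x) - Real.log (B₁ x))) / (2 * η) := by
    intro x
    have p₀ := hB₀ x
    have p₁ := hB₁ x
    set u := Real.sqrt (B₀ x) with hu
    set v := Real.sqrt (B₁ x) with hv
    have hu0 : 0 < u := Real.sqrt_pos.2 p₀
    have hv0 : 0 < v := Real.sqrt_pos.2 p₁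
    have hu2 : B₀ x = u ^ 2 := (Real.sq_sqrt p₀.le).symm
    have hv2 : B₁ x = v ^ 2 := (Real.sq_sqrt p₁.le).symm
    rw [hu2, hv2, Real.log_pow, Real.log_pow]
    -- Applied to the square roots, `log y ≤ y - 1` bounds the squared Hellinger distance by the
    -- divergence, once the terms `v ^ 2 - u ^ 2` cancel in the sum.
    have hlog : Real.log v - Real.log u ≤ v / u - 1 := by
      rw [← Real.log_div hv0.ne' hu0.ne']
      exact Real.log_le_sub_one_of_pos (div_pos hv0 hu0)
    have hlog' : (v - u) ^ 2 ≤ v ^ 2 - u ^ 2 + u ^ 2 * (2 * Real.log u - 2 * Real.log v) := by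
      have h := mul_le_mul_of_nonneg_left hlog (sq_nonneg u)
      have e : u ^ 2 * (v / u - 1) = u * v - u ^ 2 := by field_simp
      nlinarith
    -- The weighted AM-GM inequality for `|v - u| * (v + u)`.
    have hdiff : (v ^ 2 - u ^ 2) * Y x ≤ η * (u ^ 2 + v ^ 2) + (v - u) ^ 2 / (2 * η) := by
      have h1 : (v ^ 2 - u ^ 2) * Y x ≤ |v ^ 2 - u ^ 2| :=
        (le_abs_self _).trans (by
          rw [abs_mul, abs_of_nonneg (hY₀ x)]
          exact mul_le_of_le_one_right (abs_nonneg _) (hY₁ x))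
      have h2 : |v ^ 2 - u ^ 2| = |v - u| * (v + u) := by
        rw [show v ^ 2 - u ^ 2 = (v - u) * (v + u) by ring, abs_mul, abs_of_pos (add_pos hv0 hu0)]
      have h3 : |v - u| * (v + u) ≤ η * (u ^ 2 + v ^ 2) + (v - u) ^ 2 / (2 * η) := by
        have h4 : |v - u| * (v + u) ≤ η / 2 * (v + u) ^ 2 + |v - u| ^ 2 / (2 * η) := by
          have : η / 2 * (v + u) ^ 2 + |v - u| ^ 2 / (2 * η) - |v - u| * (v + u)
              = (η * (v + u) - |v - u|) ^ 2 / (2 * η) := by field_simp; ring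
          have : 0 ≤ (η * (v + u) - |v - u|) ^ 2 / (2 * η) := by positivity
          linarith
        rw [sq_abs] at h4
        nlinarith [mul_nonneg hη.le (sq_nonneg (v - u))]
      linarith
    have hdiv := div_le_div_of_nonneg_right hlog' (by positivity : (0 : ℝ) ≤ 2 * η)
    have := mul_le_mul_of_nonneg_left (hdiff.trans (add_le_add le_rfl hdiv)) (hA x)
    push_cast
    calc A x * v ^ 2 * Y x = A x * u ^ 2 * Y x + A x * ((v ^ 2 - u ^ 2) * Y x) := by ring
      _ ≤ _ := add_le_add le_rfl this
      _ = _ := by ring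
  refine (Finset.sum_le_sum fun x _ => key x).trans (le_of_eq ?_)
  rw [Finset.sum_add_distrib, Finset.sum_add_distrib, ← Finset.mul_sum, ← Finset.sum_div,
    Finset.sum_add_distrib, Finset.sum_add_distrib, Finset.sum_sub_distrib, h₀, h₁]
  ring

/-! ### Episodes whose states do not depend on the actions -/

namespace PbMDP

open SequentialProcess

variable {H K T : ℕ} {𝓢 : Type} [Fintype 𝓢] {Ω : Type*} [MeasurableSpace Ω]

theorem sum_step (f : Step K 𝓢 → ℝ) : ∑ x, f x = ∑ s, ∑ a, ∑ o, f ⟨s, a, o⟩ := by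
  rw [← (Step.equivProd K 𝓢).sum_comp, Fintype.sum_prod_type]
  simp_rw [Fintype.sum_prod_type (f := fun y : Action K × Bool => f (Step.equivProd K 𝓢 (_, y)))]
  rfl

theorem sum_bernoulliWeight (p : ℝ) : ∑ o, bernoulliWeight p o = 1 := by
  simp [bernoulliWeight]

theorem bernoulliWeight_nonneg {p : ℝ} (hp : p ∈ Set.Icc (0 : ℝ) 1) (o : Bool) :
    0 ≤ bernoulliWeight p o := by
  cases o <;> simp [bernoulliWeight, hp.1, hp.2]

theorem bernoulliWeight_pos {p : ℝ} (hp : p ∈ Set.Ioo (0 : ℝ) 1) (o : Bool) :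
    0 < bernoulliWeight p o := by
  cases o <;> simp [bernoulliWeight, hp.1, hp.2]

/-- `M.HasStateLaw q` says that the states of an episode of `M` are independent of each other and of
the actions, and that the state of step `h` has the distribution `q h`. -/
structure LayeredMDP.HasStateLaw (M : LayeredMDP H K 𝓢) (q : Fin H → 𝓢 → ℝ) : Prop where
  nonneg : ∀ h s, 0 ≤ q h s
  sum_eq_one : ∀ h, ∑ s, q h s = 1
  prod_arrivalProb : ∀ τ : Trajectory H K 𝓢, ∏ h, M.arrivalProb τ h = ∏ h, q h (τ h).state

/-- The distribution of a step when the state law does not depend on the past. -/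
def stepKernel (q : Fin H → 𝓢 → ℝ) (p : Preference K 𝓢) (π : EpisodePolicy H K 𝓢) (h : Fin H)
    (past : Fin h → Step K 𝓢) (x : Step K 𝓢) : ℝ :=
  q h x.state * π h past x.state x.action * bernoulliWeight (p.pr x.state x.action) x.feedback

/-- The mean of `f` under the distribution from which the policy `π`, after the first steps of `τ`,
draws its action of step `h` in the state `s`. -/
def actionMean (π : EpisodePolicy H K 𝓢) (τ : Trajectory H K 𝓢) (h : Fin H) (s : 𝓢)
    (f : Action K → ℝ) : ℝ :=
  ∑ a, π h (past τ h) s a * f a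

theorem actionMean_mono (π : EpisodePolicy H K 𝓢) (τ : Trajectory H K 𝓢) (h : Fin H) (s : 𝓢)
    {f g : Action K → ℝ} (hfg : ∀ a, f a ≤ g a) : actionMean π τ h s f ≤ actionMean π τ h s g :=
  Finset.sum_le_sum fun a _ =>
    mul_le_mul_of_nonneg_left (hfg a) (stdSimplex.zero_le (π h (past τ h) s) a)

theorem actionMean_const (π : EpisodePolicy H K 𝓢) (τ : Trajectory H K 𝓢) (h : Fin H) (s : 𝓢)
    (r : ℝ) : actionMean π τ h s (fun _ => r) = r := by
  rw [actionMean, ← Finset.sum_mul, stdSimplex.sum_eq_one, one_mul]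

theorem actionMean_const_mul (π : EpisodePolicy H K 𝓢) (τ : Trajectory H K 𝓢) (h : Fin H) (s : 𝓢)
    (r : ℝ) (f : Action K → ℝ) :
    actionMean π τ h s (fun a => r * f a) = r * actionMean π τ h s f := by
  rw [actionMean, actionMean, Finset.mul_sum]
  exact Finset.sum_congr rfl fun a _ => by ring

theorem actionMean_sub (π : EpisodePolicy H K 𝓢) (τ : Trajectory H K 𝓢) (h : Fin H) (s : 𝓢)
    (f g : Action K → ℝ) :
    actionMean π τ h s (fun a => f a - g a) = actionMean π τ h s f - actionMean π τ h s g := by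
  simp_rw [actionMean, mul_sub, Finset.sum_sub_distrib]

theorem sum_actionMean {ι : Type*} (A : Finset ι) (π : EpisodePolicy H K 𝓢)
    (τ : Trajectory H K 𝓢) (h : Fin H) (s : 𝓢) (f : ι → Action K → ℝ) :
    ∑ i ∈ A, actionMean π τ h s (f i) = actionMean π τ h s (fun a => ∑ i ∈ A, f i a) := by
  simp_rw [actionMean, Finset.mul_sum]
  exact Finset.sum_comm

theorem sum_stepKernel_mul (q : Fin H → 𝓢 → ℝ) (p : Preference K 𝓢) (π : EpisodePolicy H K 𝓢)
    (h : Fin H) (past : Fin h → Step K 𝓢) (f : Step K 𝓢 → ℝ) :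
    ∑ x, stepKernel q p π h past x * f x
      = ∑ s, q h s * ∑ a, π h past s a * ∑ o, bernoulliWeight (p.pr s a) o * f ⟨s, a, o⟩ := by
  rw [sum_step]
  simp_rw [Finset.mul_sum, stepKernel, mul_assoc]

theorem trajectoryProb_nonneg (M : LayeredMDP H K 𝓢) (p : Preference K 𝓢)
    (π : EpisodePolicy H K 𝓢) (τ : Trajectory H K 𝓢) : 0 ≤ M.trajectoryProb p π τ := by
  refine Finset.prod_nonneg fun h _ => mul_nonneg (mul_nonneg ?_ (stdSimplex.zero_le _ _))
    (bernoulliWeight_nonneg (p.mem_Icc _ _) _)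
  unfold LayeredMDP.arrivalProb
  split_ifs
  · exact zero_le_one
  · exact le_rfl
  · exact stdSimplex.zero_le _ _

theorem interactionProb_nonneg (I : Instance H K T 𝓢) (L : Learner H K 𝓢 Ω) (ω : Ω)
    (τ : Fin T → Trajectory H K 𝓢) : 0 ≤ I.interactionProb L ω τ :=
  Finset.prod_nonneg fun _ _ => trajectoryProb_nonneg _ _ _ _

namespace LayeredMDP.HasStateLaw

variable {M : LayeredMDP H K 𝓢} {q : Fin H → 𝓢 → ℝ}

theorem sum_stepKernel (hM : M.HasStateLaw q) (p : Preference K 𝓢) (π : EpisodePolicy H K 𝓢)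
    (h : Fin H) (past : Fin h → Step K 𝓢) : ∑ x, stepKernel q p π h past x = 1 := by
  have := sum_stepKernel_mul q p π h past (fun _ => 1)
  simp only [mul_one, sum_bernoulliWeight, stdSimplex.sum_eq_one, hM.sum_eq_one] at this
  exact this

theorem trajectoryProb_eq (hM : M.HasStateLaw q) (p : Preference K 𝓢) (π : EpisodePolicy H K 𝓢)
    (τ : Trajectory H K 𝓢) : M.trajectoryProb p π τ = weight (stepKernel q p π) τ := by
  unfold LayeredMDP.trajectoryProb weight stepKernel
  rw [Finset.prod_mul_distrib, Finset.prod_mul_distrib, hM.prod_arrivalProb,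
    ← Finset.prod_mul_distrib, ← Finset.prod_mul_distrib]

theorem sum_trajectoryProb (hM : M.HasStateLaw q) (p : Preference K 𝓢) (π : EpisodePolicy H K 𝓢) :
    ∑ τ, M.trajectoryProb p π τ = 1 := by
  simp_rw [hM.trajectoryProb_eq]
  exact sum_weight _ (hM.sum_stepKernel p π)

/-- The state of step `h` is independent of the past, so its weight `q h s` factors out. What
remains averages the action the policy would draw in `s`, whether or not `s` is visited. -/
theorem sum_trajectoryProb_mul (hM : M.HasStateLaw q) (p : Preference K 𝓢)
    (π : EpisodePolicy H K 𝓢) (h : Fin H) (f : Step K 𝓢 → ℝ) :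
    ∑ τ, M.trajectoryProb p π τ * f (τ h)
      = ∑ s, q h s * ∑ τ, M.trajectoryProb p π τ
          * actionMean π τ h s fun a => ∑ o, bernoulliWeight (p.pr s a) o * f ⟨s, a, o⟩ := by
  simp_rw [hM.trajectoryProb_eq]
  rw [sum_weight_mul _ (hM.sum_stepKernel p π) h fun _ x => f x]
  simp_rw [sum_stepKernel_mul, Finset.mul_sum (s := Finset.univ (α := Trajectory H K 𝓢))]
  rw [Finset.sum_comm]
  refine Finset.sum_congr rfl fun τ _ => ?_
  rw [Finset.mul_sum]
  exact Finset.sum_congr rfl fun s _ => mul_left_comm _ _ _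

theorem value_eq (hM : M.HasStateLaw q) (p : Preference K 𝓢) (ℓ : 𝓢 → Action K → ℝ)
    (π : EpisodePolicy H K 𝓢) :
    M.value p ℓ π
      = ∑ h, ∑ s, q h s * ∑ τ, M.trajectoryProb p π τ * actionMean π τ h s (ℓ s) := by
  unfold LayeredMDP.value
  simp_rw [Finset.mul_sum]
  rw [Finset.sum_comm]
  refine Finset.sum_congr rfl fun h _ => ?_
  rw [hM.sum_trajectoryProb_mul p π h fun x => ℓ x.state x.action]
  simp_rw [← Finset.sum_mul, sum_bernoulliWeight, one_mul, Finset.mul_sum]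

theorem sum_interactionProb_mul_tower (hM : M.HasStateLaw q) (pref : Fin T → Preference K 𝓢)
    (L : Learner H K 𝓢 Ω) (ω : Ω) (t : Fin T)
    (f : (Fin t → Trajectory H K 𝓢) → Trajectory H K 𝓢 → ℝ) :
    ∑ τ, (Instance.mk M pref).interactionProb L ω τ * f (past τ t) (τ t)
      = ∑ τ, (Instance.mk M pref).interactionProb L ω τ
          * ∑ x, M.trajectoryProb (pref t) (L.policy M t (past τ t) ω) x * f (past τ t) x :=
  sum_weight_mul (fun (t : Fin T) past x => M.trajectoryProb (pref t) (L.policy M t past ω) x)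
    (fun _ _ => hM.sum_trajectoryProb _ _) t f

theorem sum_interactionProb (hM : M.HasStateLaw q) (pref : Fin T → Preference K 𝓢)
    (L : Learner H K 𝓢 Ω) (ω : Ω) :
    ∑ τ, (Instance.mk M pref).interactionProb L ω τ = 1 :=
  sum_weight (fun (t : Fin T) past x => M.trajectoryProb (pref t) (L.policy M t past ω) x)
    (fun _ _ => hM.sum_trajectoryProb _ _)

/-- The expectation, over the interaction, of `actionMean` in episode `t`, step `h` and state `s`. -/
def _root_.PbMDP.expectedActionMean (M : LayeredMDP H K 𝓢) (pref : Fin T → Preference K 𝓢)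
    (L : Learner H K 𝓢 Ω) (ω : Ω) (t : Fin T) (h : Fin H) (s : 𝓢) (f : Action K → ℝ) : ℝ :=
  ∑ τ, (Instance.mk M pref).interactionProb L ω τ
    * actionMean ((Instance.mk M pref).policyAt L ω τ t) (τ t) h s f

theorem sum_interactionProb_mul (hM : M.HasStateLaw q) (pref : Fin T → Preference K 𝓢)
    (L : Learner H K 𝓢 Ω) (ω : Ω) (t : Fin T) (h : Fin H) (f : Step K 𝓢 → ℝ) :
    ∑ τ, (Instance.mk M pref).interactionProb L ω τ * f (τ t h)
      = ∑ s, q h s * expectedActionMean M pref L ω t h s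
          fun a => ∑ o, bernoulliWeight ((pref t).pr s a) o * f ⟨s, a, o⟩ := by
  rw [hM.sum_interactionProb_mul_tower pref L ω t fun _ x => f (x h)]
  simp_rw [hM.sum_trajectoryProb_mul, Finset.mul_sum (s := Finset.univ (α := 𝓢))]
  rw [Finset.sum_comm]
  refine Finset.sum_congr rfl fun s _ => ?_
  rw [expectedActionMean, Finset.mul_sum]
  simp_rw [mul_left_comm _ (q h s)]
  rw [← Finset.mul_sum, ← Finset.mul_sum]
  congr 1
  exact (hM.sum_interactionProb_mul_tower pref L ω t fun past x =>
    actionMean (L.policy M t past ω) x h s _).symm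

theorem sum_interactionProb_mul_value (hM : M.HasStateLaw q) (pref : Fin T → Preference K 𝓢)
    (L : Learner H K 𝓢 Ω) (ω : Ω) (t : Fin T) (ℓ : 𝓢 → Action K → ℝ) :
    ∑ τ, (Instance.mk M pref).interactionProb L ω τ
        * M.value (pref t) ℓ ((Instance.mk M pref).policyAt L ω τ t)
      = ∑ h, ∑ s, q h s * expectedActionMean M pref L ω t h s (ℓ s) := by
  simp_rw [hM.value_eq, Finset.mul_sum (s := Finset.univ (α := Fin H)),
    Finset.mul_sum (s := Finset.univ (α := 𝓢))]
  rw [Finset.sum_comm]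
  refine Finset.sum_congr rfl fun h _ => ?_
  rw [Finset.sum_comm]
  refine Finset.sum_congr rfl fun s _ => ?_
  simp_rw [mul_left_comm _ (q h s)]
  rw [← Finset.mul_sum]
  congr 1
  exact (hM.sum_interactionProb_mul_tower pref L ω t fun past x =>
    actionMean (L.policy M t past ω) x h s (ℓ s)).symm

theorem expectedActionMean_const (hM : M.HasStateLaw q) (pref : Fin T → Preference K 𝓢)
    (L : Learner H K 𝓢 Ω) (ω : Ω) (t : Fin T) (h : Fin H) (s : 𝓢) (r : ℝ) :
    expectedActionMean M pref L ω t h s (fun _ => r) = r := by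
  simp_rw [expectedActionMean, actionMean_const]
  rw [← Finset.sum_mul, hM.sum_interactionProb, one_mul]

end LayeredMDP.HasStateLaw

section ExpectedActionMean

variable (M : LayeredMDP H K 𝓢) (pref : Fin T → Preference K 𝓢)
    (L : Learner H K 𝓢 Ω) (ω : Ω) (t : Fin T) (h : Fin H) (s : 𝓢)

theorem expectedActionMean_mono {f g : Action K → ℝ} (hfg : ∀ a, f a ≤ g a) :
    expectedActionMean M pref L ω t h s f ≤ expectedActionMean M pref L ω t h s g :=
  Finset.sum_le_sum fun _ _ =>
    mul_le_mul_of_nonneg_left (actionMean_mono _ _ _ _ hfg) (interactionProb_nonneg _ _ _ _)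

theorem expectedActionMean_const_mul (r : ℝ) (f : Action K → ℝ) :
    expectedActionMean M pref L ω t h s (fun a => r * f a)
      = r * expectedActionMean M pref L ω t h s f := by
  simp_rw [expectedActionMean, actionMean_const_mul, mul_left_comm _ r, Finset.mul_sum]

theorem expectedActionMean_sub (f g : Action K → ℝ) :
    expectedActionMean M pref L ω t h s (fun a => f a - g a)
      = expectedActionMean M pref L ω t h s f - expectedActionMean M pref L ω t h s g := by
  simp_rw [expectedActionMean, actionMean_sub, mul_sub, Finset.sum_sub_distrib]

theorem sum_expectedActionMean {ι : Type*} (A : Finset ι) (f : ι → Action K → ℝ) :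
    ∑ i ∈ A, expectedActionMean M pref L ω t h s (f i)
      = expectedActionMean M pref L ω t h s (fun a => ∑ i ∈ A, f i a) := by
  simp_rw [expectedActionMean]
  rw [Finset.sum_comm]
  simp_rw [← Finset.mul_sum, sum_actionMean]

theorem expectedActionMean_nonneg {f : Action K → ℝ} (hf : ∀ a, 0 ≤ f a) :
    0 ≤ expectedActionMean M pref L ω t h s f :=
  Finset.sum_nonneg fun _ _ => mul_nonneg (interactionProb_nonneg _ _ _ _)
    (Finset.sum_nonneg fun a _ => mul_nonneg (stdSimplex.zero_le _ a) (hf a))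

end ExpectedActionMean

end PbMDP

/-! ### Divergence between two interactions -/

namespace PbMDP

open SequentialProcess

variable {H K T : ℕ} {𝓢 : Type} [Fintype 𝓢] {Ω : Type*} [MeasurableSpace Ω]

/-- The Kullback–Leibler divergence between the Bernoulli distributions with means `a` and `b`. -/
def bernoulliKL (a b : ℝ) : ℝ :=
  ∑ o, bernoulliWeight a o * (Real.log (bernoulliWeight a o) - Real.log (bernoulliWeight b o))

theorem bernoulliKL_self (a : ℝ) : bernoulliKL a a = 0 := by
  simp [bernoulliKL]

/-- By `log y ≤ y - 1` in both outcomes, the divergence is at most the chi-squared divergence. -/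
theorem bernoulliKL_le {a b : ℝ} (ha : a ∈ Set.Ioo (0 : ℝ) 1) (hb : b ∈ Set.Ioo (0 : ℝ) 1) :
    bernoulliKL a b ≤ (a - b) ^ 2 / (b * (1 - b)) := by
  have key : ∀ x y : ℝ, 0 < x → 0 < y → x * (Real.log x - Real.log y) ≤ x * (x / y - 1) :=
    fun x y hx hy => by
      rw [← Real.log_div hx.ne' hy.ne']
      exact mul_le_mul_of_nonneg_left (Real.log_le_sub_one_of_pos (div_pos hx hy)) hx.le
  have h1 := key a b ha.1 hb.1
  have h2 := key (1 - a) (1 - b) (sub_pos.2 ha.2) (sub_pos.2 hb.2)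
  have hb1 : b ≠ 0 := hb.1.ne'
  have hb2 : 1 - b ≠ 0 := (sub_pos.2 hb.2).ne'
  have e : a * (a / b - 1) + (1 - a) * ((1 - a) / (1 - b) - 1) = (a - b) ^ 2 / (b * (1 - b)) := by
    field_simp
    ring
  simp only [bernoulliKL, Fintype.sum_bool, bernoulliWeight, if_true, Bool.false_eq_true, if_false]
  linarith

/-- Under two preference functions that give every outcome a positive probability, the expected
action means of a `[0, 1]`-valued function differ by little unless the learner plays often where the
preference functions differ. -/
theorem LayeredMDP.HasStateLaw.expectedActionMean_le_add_kl {M : LayeredMDP H K 𝓢}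
    {q : Fin H → 𝓢 → ℝ} (hM : M.HasStateLaw q) {p₀ p₁ : Preference K 𝓢}
    (hp₀ : ∀ s a, p₀.pr s a ∈ Set.Ioo (0 : ℝ) 1) (hp₁ : ∀ s a, p₁.pr s a ∈ Set.Ioo (0 : ℝ) 1)
    (L : Learner H K 𝓢 Ω) (ω : Ω) (t : Fin T) (h : Fin H) (s : 𝓢) {f : Action K → ℝ}
    (hf₀ : ∀ a, 0 ≤ f a) (hf₁ : ∀ a, f a ≤ 1) {η : ℝ} (hη : 0 < η) :
    expectedActionMean M (fun _ : Fin T => p₁) L ω t h s f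
      ≤ expectedActionMean M (fun _ => p₀) L ω t h s f + 2 * η
        + (∑ t : Fin T, ∑ h, ∑ s, q h s * expectedActionMean M (fun _ => p₀) L ω t h s
            fun a => bernoulliKL (p₀.pr s a) (p₁.pr s a)) / (2 * η) := by
  -- The factor `A` of arrivals and policies is common to both environments and may vanish; only the
  -- feedback likelihood `B` depends on the preferences and enters the logarithms.
  let A : (Fin T → Trajectory H K 𝓢) → ℝ := fun τ => ∏ t, ∏ h, (M.arrivalProb (τ t) h
    * L.policy M t (past τ t) ω h (past (τ t) h) (τ t h).state (τ t h).action)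
  let B : Preference K 𝓢 → (Fin T → Trajectory H K 𝓢) → ℝ := fun p τ =>
    ∏ t, ∏ h, bernoulliWeight (p.pr (τ t h).state (τ t h).action) (τ t h).feedback
  have hAB : ∀ p τ, (Instance.mk M fun _ => p).interactionProb L ω τ = A τ * B p τ := fun p τ => by
    simp only [A, B, Instance.interactionProb, LayeredMDP.trajectoryProb, Finset.prod_mul_distrib]
    rfl
  have hA : ∀ τ, 0 ≤ A τ := fun τ => by
    refine Finset.prod_nonneg fun t _ => Finset.prod_nonneg fun h _ =>
      mul_nonneg ?_ (stdSimplex.zero_le _ _)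
    unfold LayeredMDP.arrivalProb
    split_ifs
    · exact zero_le_one
    · exact le_rfl
    · exact stdSimplex.zero_le _ _
  have hB : ∀ p : Preference K 𝓢, (∀ s a, p.pr s a ∈ Set.Ioo (0 : ℝ) 1) → ∀ τ, 0 < B p τ :=
    fun p hp τ => Finset.prod_pos fun t _ => Finset.prod_pos fun h _ => bernoulliWeight_pos (hp _ _) _
  have hsum : ∀ p, ∑ τ, A τ * B p τ = 1 := fun p => by
    simp_rw [← hAB]
    exact hM.sum_interactionProb _ L ω
  have hlog : ∀ p : Preference K 𝓢, (∀ s a, p.pr s a ∈ Set.Ioo (0 : ℝ) 1) → ∀ τ,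
      Real.log (B p τ) = ∑ t, ∑ h,
        Real.log (bernoulliWeight (p.pr (τ t h).state (τ t h).action) (τ t h).feedback) :=
    fun p hp τ => by
      simp only [B]
      rw [Real.log_prod fun t _ =>
        (Finset.prod_pos fun h _ => bernoulliWeight_pos (hp _ _) _).ne']
      exact Finset.sum_congr rfl fun t _ =>
        Real.log_prod fun h _ => (bernoulliWeight_pos (hp _ _) _).ne'
  have hKL : ∑ τ, A τ * B p₀ τ * (Real.log (B p₀ τ) - Real.log (B p₁ τ))
      = ∑ t : Fin T, ∑ h, ∑ s, q h s * expectedActionMean M (fun _ => p₀) L ω t h s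
            fun a => bernoulliKL (p₀.pr s a) (p₁.pr s a) := by
    simp_rw [hlog p₀ hp₀, hlog p₁ hp₁, ← Finset.sum_sub_distrib, Finset.mul_sum]
    rw [Finset.sum_comm]
    refine Finset.sum_congr rfl fun t _ => ?_
    rw [Finset.sum_comm]
    refine Finset.sum_congr rfl fun h _ => ?_
    simp_rw [← hAB]
    exact hM.sum_interactionProb_mul (fun _ => p₀) L ω t h fun x =>
      Real.log (bernoulliWeight (p₀.pr x.state x.action) x.feedback)
        - Real.log (bernoulliWeight (p₁.pr x.state x.action) x.feedback)
  have main := sum_mul_le_sum_mul_add_kl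
    (Y := fun τ => actionMean (L.policy M t (past τ t) ω) (τ t) h s f)
    hA (hB p₀ hp₀) (hB p₁ hp₁) (hsum p₀) (hsum p₁)
    (fun τ => (actionMean_const _ _ h s 0).symm.le.trans (actionMean_mono _ _ h s hf₀))
    (fun τ => (actionMean_mono _ _ h s hf₁).trans (actionMean_const _ _ h s 1).le) hη
  rw [hKL] at main
  simp_rw [← hAB] at main
  exact main

end PbMDP

/-! ### Hard preference functions -/

namespace PbMDP

variable {K : ℕ} {𝓢 : Type}

/-- The arms of the first half. -/
def goodArms (K : ℕ) : Finset (Fin K) := Finset.univ.filter fun i => (i : ℕ) < (K + 1) / 2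

theorem card_goodArms (K : ℕ) : (goodArms K).card = (K + 1) / 2 := by
  rw [goodArms, Fin.card_filter_val_lt]
  omega

/-- Arms of the same half are on a par; those of the first half win against those of the second half
with probability `3 / 4`, except for the arm `v`, whose probability is larger by `ε`. -/
def hardProb (ε : ℝ) (v : Fin K) (a : Action K) : ℝ :=
  if a.1 ∈ goodArms K then
    if a.2 ∈ goodArms K then 1 / 2 else 3 / 4 + if a.1 = v then ε else 0
  else
    if a.2 ∈ goodArms K then 1 / 4 - if a.2 = v then ε else 0 else 1 / 2

theorem hardProb_mem {ε : ℝ} (h₀ : 0 ≤ ε) (h₁ : ε ≤ 1 / 8) (v : Fin K) (a : Action K) :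
    hardProb ε v a ∈ Set.Icc (1 / 8 : ℝ) (7 / 8) := by
  unfold hardProb
  split_ifs <;> constructor <;> linarith

theorem hardProb_mem_Ioo {ε : ℝ} (h₀ : 0 ≤ ε) (h₁ : ε ≤ 1 / 8) (v : Fin K) (a : Action K) :
    hardProb ε v a ∈ Set.Ioo (0 : ℝ) 1 := by
  have h := hardProb_mem h₀ h₁ v a
  exact ⟨by linarith [h.1], by linarith [h.2]⟩

/-- The preference function with the best arm `θ s` in the state `s`; when `θ s` is in the second
half, all arms of the first half are equally good. -/
def hardPreference {ε : ℝ} (h₀ : 0 ≤ ε) (h₁ : ε ≤ 1 / 8) (θ : 𝓢 → Fin K) : Preference K 𝓢 where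
  pr s a := hardProb ε (θ s) a
  mem_Icc s a := Set.Ioo_subset_Icc_self (hardProb_mem_Ioo h₀ h₁ (θ s) a)
  skew s i j := by
    unfold hardProb
    split_ifs <;> linarith

/-- The indicator of the pairs that contain an arm of the second half. -/
def badIndicator (a : Action K) : ℝ := if a.1 ∈ goodArms K ∧ a.2 ∈ goodArms K then 0 else 1

/-- The indicator of the pairs whose feedback depends on whether `v` is the best arm. -/
def informative (v : Fin K) (a : Action K) : ℝ :=
  if (a.1 = v ∧ a.2 ∉ goodArms K) ∨ (a.2 = v ∧ a.1 ∉ goodArms K) then 1 else 0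

theorem badIndicator_nonneg (a : Action K) : 0 ≤ badIndicator a := by
  unfold badIndicator
  split_ifs <;> norm_num

/-- Only a pair of one good and one bad arm is informative, and only about its good arm. Hence one
exploratory play is shared among all candidates. -/
theorem sum_informative_le (a : Action K) :
    ∑ v ∈ goodArms K, informative v a ≤ badIndicator a := by
  unfold badIndicator
  by_cases h1 : a.1 ∈ goodArms K <;> by_cases h2 : a.2 ∈ goodArms K <;>
    simp only [informative, h1, h2, not_true, not_false_eq_true, and_true, and_false, or_false,
      false_or, if_true, if_false, Finset.sum_const_zero, le_refl, Finset.sum_ite_eq]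
  refine (Finset.sum_eq_zero fun v hv => if_neg ?_).trans_le zero_le_one
  rintro (rfl | rfl)
  exacts [h1 hv, h2 hv]

section Loss

variable {ε : ℝ} (h₀ : 0 ≤ ε) (h₁ : ε ≤ 1 / 8) (θ : 𝓢 → Fin K) (s : 𝓢)

theorem borda_nonpos (p : Preference K 𝓢) (i : Fin K) : p.borda s i ≤ 0 :=
  mul_nonpos_of_nonneg_of_nonpos (by positivity)
    (Finset.sum_nonpos fun j _ => sub_nonpos.2 (p.mem_Icc s (i, j)).2)

theorem loss_nonneg (p : Preference K 𝓢) (a : Action K) : 0 ≤ p.loss s a := by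
  unfold Preference.loss
  linarith [borda_nonpos s p a.1, borda_nonpos s p a.2]

theorem mul_borda (hK : K ≠ 0) (p : Preference K 𝓢) (i : Fin K) :
    (K : ℝ) * p.borda s i = ∑ j, p.pr s (i, j) - K := by
  rw [Preference.borda, ← mul_assoc, mul_one_div_cancel (Nat.cast_ne_zero.2 hK), one_mul,
    Finset.sum_sub_distrib]
  simp

theorem mul_borda_hardPreference_of_mem {i : Fin K} (hi : i ∈ goodArms K) :
    (K : ℝ) * (hardPreference h₀ h₁ θ).borda s i
      = ((K : ℝ) - (goodArms K).card) * (1 / 4 + if i = θ s then ε else 0) - K / 2 := by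
  have hpr : ∀ j, (hardPreference h₀ h₁ θ).pr s (i, j) = (3 / 4 + if i = θ s then ε else 0)
      - if j ∈ goodArms K then (1 / 4 + if i = θ s then ε else 0) else 0 := fun j => by
    simp only [hardPreference, hardProb, hi, if_true]
    split_ifs <;> ring
  rw [mul_borda s (Fin.pos i).ne']
  simp_rw [hpr]
  rw [Finset.sum_sub_distrib, Finset.sum_ite_mem]
  simp only [Finset.univ_inter, Finset.sum_const, Finset.card_univ, Fintype.card_fin, nsmul_eq_mul]
  ring

theorem mul_borda_hardPreference_of_notMem {i : Fin K} (hi : i ∉ goodArms K) :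
    (K : ℝ) * (hardPreference h₀ h₁ θ).borda s i
      = -(K : ℝ) / 2 - (goodArms K).card / 4 - if θ s ∈ goodArms K then ε else 0 := by
  have hpr : ∀ j, (hardPreference h₀ h₁ θ).pr s (i, j) = 1 / 2
      - if j ∈ goodArms K then (1 / 4 + if j = θ s then ε else 0) else 0 := fun j => by
    simp only [hardPreference, hardProb, hi, if_false]
    split_ifs <;> ring
  rw [mul_borda s (Fin.pos i).ne']
  simp_rw [hpr]
  rw [Finset.sum_sub_distrib, Finset.sum_ite_mem]
  simp only [Finset.univ_inter, Finset.sum_add_distrib, Finset.sum_const, Finset.card_univ,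
    Fintype.card_fin, nsmul_eq_mul, Finset.sum_ite_eq']
  ring

/-- The extreme case is `K = 5`, with three good and two bad arms. -/
theorem two_fifths_mul_le (hK : 5 ≤ K) : 2 / 5 * (K : ℝ) ≤ (K : ℝ) - (goodArms K).card := by
  have : 2 * K + 5 * (goodArms K).card ≤ 5 * K := by rw [card_goodArms]; omega
  have : (2 : ℝ) * K + 5 * (goodArms K).card ≤ 5 * K := by exact_mod_cast this
  linarith

theorem half_mul_le : (K : ℝ) / 2 ≤ (goodArms K).card := by
  have : K ≤ 2 * (goodArms K).card := by rw [card_goodArms]; omega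
  have : (K : ℝ) ≤ 2 * (goodArms K).card := by exact_mod_cast this
  linarith

/-- An optimal arm in the state with parameter `v`. -/
def bestArm (v : Fin K) : Fin K := if v ∈ goodArms K then v else ⟨0, Fin.pos v⟩

theorem bestArm_mem (v : Fin K) : bestArm v ∈ goodArms K := by
  unfold bestArm
  split_ifs with h
  · exact h
  · have := Fin.pos v
    simp only [goodArms, Finset.mem_filter, Finset.mem_univ, true_and]
    omega

/-- A bad arm loses `1 / 4` in comparison with every opponent. Two good arms differ only by the
bonus `ε` against the bad arms, which are at least `2 / 5` of all. -/
theorem borda_gap (hK : 5 ≤ K) (i : Fin K) :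
    (if i ∈ goodArms K then (if θ s ∈ goodArms K ∧ i ≠ θ s then 2 / 5 * ε else 0) else 1 / 4)
      ≤ (hardPreference h₀ h₁ θ).borda s (bestArm (θ s)) - (hardPreference h₀ h₁ θ).borda s i := by
  have hK0 : (0 : ℝ) < K := by exact_mod_cast (by omega : 0 < K)
  have hB := two_fifths_mul_le hK
  have hG := half_mul_le (K := K)
  refine le_of_mul_le_mul_left ?_ hK0
  rw [mul_sub, mul_borda_hardPreference_of_mem h₀ h₁ θ s (bestArm_mem _)]
  have hBε := mul_le_mul_of_nonneg_right hB h₀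
  by_cases hi : i ∈ goodArms K
  · rw [mul_borda_hardPreference_of_mem h₀ h₁ θ s hi, if_pos hi]
    by_cases hθ : θ s ∈ goodArms K
    · by_cases hiθ : i = θ s
      · simp [bestArm, hiθ, hθ]
      · simp only [bestArm, hθ, hiθ, if_true, if_false, ne_eq, not_false_eq_true, and_self]
        nlinarith
    · have h1 : i ≠ θ s := fun h => hθ (h ▸ hi)
      have h2 : bestArm (θ s) ≠ θ s := fun h => hθ (h ▸ bestArm_mem (θ s))
      simp [hθ, h1, h2]
  · rw [mul_borda_hardPreference_of_notMem h₀ h₁ θ s hi, if_neg hi]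
    have h3 : 0 ≤ ((K : ℝ) - (goodArms K).card) * if bestArm (θ s) = θ s then ε else 0 :=
      mul_nonneg (by linarith) (by split_ifs <;> simp [h₀])
    have h4 : 0 ≤ if θ s ∈ goodArms K then ε else 0 := by split_ifs <;> simp [h₀]
    nlinarith

theorem loss_sub_loss (p : Preference K 𝓢) (a : Action K) (u : Fin K) :
    p.loss s a - p.loss s (u, u)
      = ((p.borda s u - p.borda s a.1) + (p.borda s u - p.borda s a.2)) / 2 := by
  unfold Preference.loss
  ring

theorem loss_gap_bad (hK : 5 ≤ K) (a : Action K) :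
    1 / 8 * badIndicator a ≤ (hardPreference h₀ h₁ θ).loss s a
      - (hardPreference h₀ h₁ θ).loss s (bestArm (θ s), bestArm (θ s)) := by
  rw [loss_sub_loss]
  have g1 := borda_gap h₀ h₁ θ s hK a.1
  have g2 := borda_gap h₀ h₁ θ s hK a.2
  unfold badIndicator
  split_ifs at g1 g2 ⊢ <;> first | linarith | tauto

theorem loss_gap_good (hK : 5 ≤ K) (hθ : θ s ∈ goodArms K) (a : Action K) :
    ε / 5 * (1 - if a.1 = θ s then 1 else 0) ≤ (hardPreference h₀ h₁ θ).loss s a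
      - (hardPreference h₀ h₁ θ).loss s (bestArm (θ s), bestArm (θ s)) := by
  rw [loss_sub_loss]
  have g1 := borda_gap h₀ h₁ θ s hK a.1
  have g2 := borda_gap h₀ h₁ θ s hK a.2
  split_ifs at g1 g2 ⊢ <;> first | linarith | tauto

end Loss

/-- The null environment `v₀` and the environment `v₁` differ only on informative pairs, by at most
`ε`. Means in `[1/8, 7/8]` have variance at least `7 / 64`, and `64 / 7 ≤ 10`. -/
theorem bernoulliKL_hardProb_le {ε : ℝ} (h₀ : 0 ≤ ε) (h₁ : ε ≤ 1 / 8) {v₀ v₁ : Fin K}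
    (hv₀ : v₀ ∉ goodArms K) (a : Action K) :
    bernoulliKL (hardProb ε v₀ a) (hardProb ε v₁ a) ≤ 10 * ε ^ 2 * informative v₁ a := by
  by_cases h : (a.1 = v₁ ∧ a.2 ∉ goodArms K) ∨ (a.2 = v₁ ∧ a.1 ∉ goodArms K)
  · rw [informative, if_pos h, mul_one]
    refine (bernoulliKL_le (hardProb_mem_Ioo h₀ h₁ _ a) (hardProb_mem_Ioo h₀ h₁ _ a)).trans ?_
    have hb := hardProb_mem h₀ h₁ v₁ a
    have hd : |hardProb ε v₀ a - hardProb ε v₁ a| ≤ ε := by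
      have e : ∀ i ∈ goodArms K, i ≠ v₀ := fun i hi h => hv₀ (h ▸ hi)
      unfold hardProb
      split_ifs <;> first | exact absurd ‹_ = v₀› (e _ ‹_›) | (rw [abs_le]; constructor <;> linarith)
    have hd2 : (hardProb ε v₀ a - hardProb ε v₁ a) ^ 2 ≤ ε ^ 2 := by
      rw [← sq_abs]
      exact pow_le_pow_left₀ (abs_nonneg _) hd 2
    have hpos : 7 / 64 ≤ hardProb ε v₁ a * (1 - hardProb ε v₁ a) := by
      nlinarith [hb.1, hb.2, mul_nonneg (sub_nonneg.2 hb.1) (sub_nonneg.2 hb.2)]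
    rw [div_le_iff₀ (by linarith)]
    nlinarith [sq_nonneg ε]
  · have : hardProb ε v₀ a = hardProb ε v₁ a := by
      unfold hardProb
      split_ifs with h1 h2 h3 h4 h5 h6 h7 h8 <;> simp_all
    rw [informative, if_neg h, mul_zero, this, bernoulliKL_self]

end PbMDP

/-! ### The uniform MDP and balanced layers -/

namespace PbMDP

section UniformMDP

variable {H K : ℕ} {𝓢 : Type} [Fintype 𝓢] [DecidableEq 𝓢]

/-- The states of a layer. -/
def layerStates (layer : 𝓢 → Fin (H + 1)) (k : Fin (H + 1)) : Finset 𝓢 :=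
  Finset.univ.filter fun s => layer s = k

/-- The weights of the uniform distribution on a layer. -/
def layerWeight (layer : 𝓢 → Fin (H + 1)) (k : Fin (H + 1)) (s : 𝓢) : ℝ :=
  if layer s = k then 1 / ((layerStates layer k).card : ℝ) else 0

theorem layerWeight_nonneg (layer : 𝓢 → Fin (H + 1)) (k : Fin (H + 1)) (s : 𝓢) :
    0 ≤ layerWeight layer k s := by
  unfold layerWeight
  split_ifs <;> positivity

theorem sum_layerWeight {layer : 𝓢 → Fin (H + 1)} (hl : Function.Surjective layer)
    (k : Fin (H + 1)) : ∑ s, layerWeight layer k s = 1 := by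
  obtain ⟨s, hs⟩ := hl k
  have hne : ((layerStates layer k).card : ℝ) ≠ 0 :=
    Nat.cast_ne_zero.2 (Finset.card_ne_zero_of_mem (a := s) (by simp [layerStates, hs]))
  unfold layerWeight
  rw [← Finset.sum_filter, Finset.sum_const, nsmul_eq_mul]
  exact mul_one_div_cancel hne

/-- The successor of a layer; the last layer is its own successor. -/
def nextLayer (k : Fin (H + 1)) : Fin (H + 1) := ⟨min (k + 1) H, by omega⟩

/-- The layered MDP in which every action leads to a uniformly random state of the next layer. -/
def uniformMDP (K : ℕ) (layer : 𝓢 → Fin (H + 1)) (hl : Function.Surjective layer) (s₀ s₁ : 𝓢)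
    (h₀ : ∀ s, layer s = 0 ↔ s = s₀) (h₁ : ∀ s, layer s = Fin.last H ↔ s = s₁) :
    LayeredMDP H K 𝓢 where
  layer := layer
  layer_surjective := hl
  initial := s₀
  terminal := s₁
  layer_initial := h₀
  layer_terminal := h₁
  transition s _ := ⟨layerWeight layer (nextLayer (layer s)),
    layerWeight_nonneg layer _, sum_layerWeight hl _⟩
  forward s a s' hs hs' := by
    refine if_neg fun h => hs' ?_
    rw [h]
    simp only [nextLayer]
    omega

theorem uniformMDP_hasStateLaw (layer : 𝓢 → Fin (H + 1)) (hl : Function.Surjective layer)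
    (s₀ s₁ : 𝓢) (h₀ : ∀ s, layer s = 0 ↔ s = s₀) (h₁ : ∀ s, layer s = Fin.last H ↔ s = s₁) :
    (uniformMDP K layer hl s₀ s₁ h₀ h₁).HasStateLaw fun h => layerWeight layer h.castSucc where
  nonneg _ _ := layerWeight_nonneg _ _ _
  sum_eq_one _ := sum_layerWeight hl _
  prod_arrivalProb τ := by
    have hzero : ∀ h : Fin H, (h : ℕ) = 0 →
        (uniformMDP K layer hl s₀ s₁ h₀ h₁).arrivalProb τ h
          = layerWeight layer h.castSucc (τ h).state := fun h hh => by
      have hc : h.castSucc = 0 := Fin.ext hh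
      have hcard : (layerStates layer 0).card = 1 := by
        simp [layerStates, h₀, Finset.filter_eq']
      simp [LayeredMDP.arrivalProb, hh, hc, layerWeight, h₀, hcard, uniformMDP]
      congr
    have hsucc : ∀ h : Fin H, (h : ℕ) ≠ 0 →
        (∀ g : Fin H, g < h → layer (τ g).state = g.castSucc) →
        (uniformMDP K layer hl s₀ s₁ h₀ h₁).arrivalProb τ h
          = layerWeight layer h.castSucc (τ h).state := fun h hh hg => by
      have hlt : (h : ℕ) - 1 < h := by omega
      have hprev := hg ⟨(h : ℕ) - 1, hlt.trans h.isLt⟩ hlt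
      have hnext : nextLayer (Fin.castSucc (⟨(h : ℕ) - 1, hlt.trans h.isLt⟩ : Fin H))
          = h.castSucc := by
        apply Fin.ext
        have := h.isLt
        simp only [nextLayer, Fin.val_castSucc]
        omega
      rw [LayeredMDP.arrivalProb, if_neg hh, ← hnext, ← hprev]
      rfl
    have hstep : ∀ h : Fin H, (∀ g : Fin H, g < h → layer (τ g).state = g.castSucc) →
        (uniformMDP K layer hl s₀ s₁ h₀ h₁).arrivalProb τ h
          = layerWeight layer h.castSucc (τ h).state := fun h hg => by
      by_cases hh : (h : ℕ) = 0
      exacts [hzero h hh, hsucc h hh hg]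
    by_cases hall : ∀ h : Fin H, layer (τ h).state = h.castSucc
    · exact Finset.prod_congr rfl fun h _ => hstep h fun g _ => hall g
    -- If the trajectory leaves the layering, both products vanish: up to its first misplaced step
    -- the factors agree, and there both are zero.
    · push Not at hall
      obtain ⟨h, hh, hmin⟩ := WellFounded.has_min (wellFounded_lt (α := Fin H))
        {h | layer (τ h).state ≠ h.castSucc} hall
      have hq : layerWeight layer h.castSucc (τ h).state = 0 := if_neg hh
      have hg := hstep h fun g hgh => by
        by_contra hne
        exact hmin g hne hgh
      rw [Finset.prod_eq_zero (Finset.mem_univ h) (hg.trans hq),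
        Finset.prod_eq_zero (Finset.mem_univ h) hq]

end UniformMDP

/-- A layering of `S` states with singletons as first and last layers, and balanced layers in
between. -/
def balancedLayer (H S : ℕ) (hH : 2 ≤ H) (s : Fin S) : Fin (H + 1) :=
  if (s : ℕ) = 0 then 0 else if (s : ℕ) = S - 1 then Fin.last H
  else ⟨((s : ℕ) - 1) % (H - 1) + 1, by
    have := Nat.mod_lt ((s : ℕ) - 1) (by omega : 0 < H - 1)
    omega⟩

section BalancedLayer

variable {H S : ℕ} (hH : 2 ≤ H)

theorem balancedLayer_eq_zero_iff (hS : H + 1 ≤ S) (s : Fin S) :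
    balancedLayer H S hH s = 0 ↔ s = ⟨0, by omega⟩ := by
  unfold balancedLayer
  split_ifs with h1 h2 <;> simp only [Fin.ext_iff, Fin.val_zero, Fin.val_last, true_iff] <;> omega

theorem balancedLayer_eq_last_iff (hS : H + 1 ≤ S) (s : Fin S) :
    balancedLayer H S hH s = Fin.last H ↔ s = ⟨S - 1, by omega⟩ := by
  have := Nat.mod_lt ((s : ℕ) - 1) (by omega : 0 < H - 1)
  unfold balancedLayer
  split_ifs with h1 h2 <;> simp only [Fin.ext_iff, Fin.val_zero, Fin.val_last, true_iff] <;> omega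

theorem div_le_card_layerStates (hS : H + 1 ≤ S) (k : Fin (H + 1)) (h0 : k ≠ 0) (h1 : k ≠ Fin.last H) :
    (S - 2) / (H - 1) ≤ (layerStates (balancedLayer H S hH) k).card := by
  have hk0 : (k : ℕ) ≠ 0 := fun h => h0 (Fin.ext h)
  have hk1 : (k : ℕ) ≠ H := fun h => h1 (Fin.ext h)
  have hk := k.isLt
  have hlt : ∀ i < (S - 2) / (H - 1), (k : ℕ) + (H - 1) * i < S - 1 := fun i hi => by
    have h2 : (H - 1) * (i + 1) ≤ (H - 1) * ((S - 2) / (H - 1)) := Nat.mul_le_mul_left _ hi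
    have h3 := Nat.mul_div_le (S - 2) (H - 1)
    rw [Nat.mul_add] at h2
    omega
  -- The inner states of layer `k` are `k`, `k + (H - 1)`, `k + 2 * (H - 1)` and so on; the default
  -- value is never taken on the range used.
  let f : ℕ → Fin S := fun i =>
    if h : (k : ℕ) + (H - 1) * i < S - 1 then ⟨(k : ℕ) + (H - 1) * i, by omega⟩ else ⟨0, by omega⟩
  have hf : ∀ i < (S - 2) / (H - 1), (f i : ℕ) = (k : ℕ) + (H - 1) * i := fun i hi => by
    simp only [f, dif_pos (hlt i hi)]
  rw [← Finset.card_range ((S - 2) / (H - 1))]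
  refine Finset.card_le_card_of_injOn f (fun i hi => ?_) fun i hi j hj hij => ?_
  · have hi := Finset.mem_range.1 hi
    have e := hf i hi
    have l := hlt i hi
    have hmod : ((f i : ℕ) - 1) % (H - 1) = k - 1 := by
      rw [e, show (k : ℕ) + (H - 1) * i - 1 = (k - 1) + (H - 1) * i by omega,
        Nat.add_mul_mod_self_left, Nat.mod_eq_of_lt (by omega)]
    refine Finset.mem_filter.2 ⟨Finset.mem_univ _, ?_⟩
    rw [balancedLayer, if_neg (by omega), if_neg (by omega)]
    apply Fin.ext
    simp only [hmod]
    omega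
  · have e := hf i (Finset.mem_range.1 hi)
    rw [hij, hf j (Finset.mem_range.1 hj)] at e
    exact (Nat.eq_of_mul_eq_mul_left (by omega : 0 < H - 1) (Nat.add_left_cancel e)).symm

theorem le_mul_card_layerStates (hS : H + 1 ≤ S) (k : Fin (H + 1)) (h0 : k ≠ 0) (h1 : k ≠ Fin.last H) :
    S ≤ 4 * H * (layerStates (balancedLayer H S hH) k).card := by
  have h := div_le_card_layerStates hH hS k h0 h1
  have hpos : 1 ≤ (S - 2) / (H - 1) := (Nat.one_le_div_iff (by omega)).2 (by omega)
  have h2 := Nat.lt_mul_div_succ (S - 2) (by omega : 0 < H - 1)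
  set m := (S - 2) / (H - 1)
  set n := (layerStates (balancedLayer H S hH) k).card
  obtain ⟨d, rfl⟩ : ∃ d, H = d + 1 := ⟨H - 1, by omega⟩
  simp only [Nat.add_sub_cancel] at h2
  -- Since `m ≥ 1`, rounding the quotient down costs at most a factor of two.
  have h3 : d * (m + 1) ≤ d * (2 * n) := Nat.mul_le_mul_left _ (by omega)
  have h4 : 4 * (d + 1) * n = 2 * (d * (2 * n)) + 4 * n := by ring
  omega

theorem balancedLayer_surjective (hS : H + 1 ≤ S) : Function.Surjective (balancedLayer H S hH) := by
  intro k
  by_cases h0 : k = 0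
  · exact ⟨_, h0 ▸ (balancedLayer_eq_zero_iff hH hS _).2 rfl⟩
  by_cases h1 : k = Fin.last H
  · exact ⟨_, h1 ▸ (balancedLayer_eq_last_iff hH hS _).2 rfl⟩
  have h := le_mul_card_layerStates hH hS k h0 h1
  obtain ⟨s, hs⟩ := Finset.card_pos.1 (Nat.pos_of_ne_zero fun h2 => by
    rw [h2, Nat.mul_zero] at h
    omega)
  exact ⟨s, (Finset.mem_filter.1 hs).2⟩

end BalancedLayer

end PbMDP

/-! ### Regret as expected excess loss -/

namespace PbMDP

open SequentialProcess

/-- Resampling one coordinate preserves the uniform distribution: exchanging `θ i` with `v` is an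
involution. -/
theorem sum_sum_update {ι V : Type*} [Fintype ι] [DecidableEq ι] [Fintype V]
    (F : (ι → V) → ℝ) (i : ι) :
    ∑ θ, ∑ v, F (Function.update θ i v) = Fintype.card V * ∑ θ, F θ := by
  have hinv : Function.Involutive fun x : (ι → V) × V => (Function.update x.1 i x.2, x.1 i) :=
    fun x => by simp
  rw [← Fintype.sum_prod_type' fun θ v => F (Function.update θ i v)]
  refine (Equiv.sum_comp (Function.Involutive.toPerm _ hinv) fun x => F x.1).trans ?_
  rw [Fintype.sum_prod_type, Finset.mul_sum]
  simp

section Regret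

variable {H K T : ℕ} {𝓢 : Type} [Fintype 𝓢] {Ω : Type*} [MeasurableSpace Ω]

theorem value_nonneg (M : LayeredMDP H K 𝓢) (p : Preference K 𝓢) (π : EpisodePolicy H K 𝓢) :
    0 ≤ M.value p p.loss π :=
  Finset.sum_nonneg fun _ _ => mul_nonneg (trajectoryProb_nonneg _ _ _ _)
    (Finset.sum_nonneg fun _ _ => loss_nonneg _ _ _)

theorem loss_le_one (hK : K ≠ 0) (p : Preference K 𝓢) (s : 𝓢) (a : Action K) :
    p.loss s a ≤ 1 := by
  have hb : ∀ i, -1 ≤ p.borda s i := fun i => by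
    have h := mul_borda s hK p i
    have hpos : (0 : ℝ) < K := Nat.cast_pos.2 (Nat.pos_of_ne_zero hK)
    have h2 : 0 ≤ ∑ j, p.pr s (i, j) := Finset.sum_nonneg fun j _ => (p.mem_Icc s (i, j)).1
    refine le_of_mul_le_mul_left ?_ hpos
    linarith
  unfold Preference.loss
  linarith [hb a.1, hb a.2]

theorem LayeredMDP.HasStateLaw.value_le {M : LayeredMDP H K 𝓢} {q : Fin H → 𝓢 → ℝ}
    (hM : M.HasStateLaw q) (hK : K ≠ 0) (p : Preference K 𝓢) (π : EpisodePolicy H K 𝓢) :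
    M.value p p.loss π ≤ H := by
  calc M.value p p.loss π ≤ ∑ τ, M.trajectoryProb p π τ * H :=
        Finset.sum_le_sum fun τ _ => mul_le_mul_of_nonneg_left
          ((Finset.sum_le_sum fun h _ => loss_le_one hK p _ _).trans (by simp))
          (trajectoryProb_nonneg _ _ _ _)
    _ = H := by rw [← Finset.sum_mul, hM.sum_trajectoryProb, one_mul]

/-- The Markov policy that plays the arm `u s` twice in the state `s`. -/
def purePolicy (u : 𝓢 → Fin K) : MarkovPolicy K 𝓢 := fun s =>
  ⟨Pi.single (u s, u s) 1, single_mem_stdSimplex ℝ _⟩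

theorem actionMean_purePolicy (u : 𝓢 → Fin K) (τ : Trajectory H K 𝓢) (h : Fin H) (s : 𝓢)
    (f : Action K → ℝ) :
    actionMean ((purePolicy u).toEpisodePolicy H) τ h s f = f (u s, u s) := by
  change ∑ a, (Pi.single (u s, u s) 1 : Action K → ℝ) a * f a = _
  rw [Finset.sum_eq_single (u s, u s)] <;> simp +contextual

theorem LayeredMDP.HasStateLaw.iInf_markovLoss_le {M : LayeredMDP H K 𝓢} {q : Fin H → 𝓢 → ℝ}
    (hM : M.HasStateLaw q) (pref : Fin T → Preference K 𝓢) (u : 𝓢 → Fin K) :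
    ⨅ π : MarkovPolicy K 𝓢, (Instance.mk M pref).markovLoss π
      ≤ ∑ t, ∑ h, ∑ s, q h s * (pref t).loss s (u s, u s) := by
  have hbdd : BddBelow (Set.range fun π : MarkovPolicy K 𝓢 => (Instance.mk M pref).markovLoss π) :=
    ⟨0, by
      rintro _ ⟨π, rfl⟩
      exact Finset.sum_nonneg fun t _ => value_nonneg M _ _⟩
  refine (ciInf_le hbdd (purePolicy u)).trans (le_of_eq ?_)
  refine Finset.sum_congr rfl fun t _ => ?_
  simp_rw [hM.value_eq, actionMean_purePolicy, ← Finset.sum_mul, hM.sum_trajectoryProb, one_mul]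

/-- The expected regret given the internal randomness `ω` of the learner. -/
def conditionalRegret (I : Instance H K T 𝓢) (L : Learner H K 𝓢 Ω) (ω : Ω) : ℝ :=
  ∑ τ : Fin T → Trajectory H K 𝓢, I.interactionProb L ω τ * I.regret L ω τ

namespace LayeredMDP.HasStateLaw

variable {M : LayeredMDP H K 𝓢} {q : Fin H → 𝓢 → ℝ}

theorem conditionalRegret_eq (hM : M.HasStateLaw q) (pref : Fin T → Preference K 𝓢)
    (L : Learner H K 𝓢 Ω) (ω : Ω) :
    conditionalRegret ⟨M, pref⟩ L ω
      = ∑ t, ∑ τ, (Instance.mk M pref).interactionProb L ω τ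
          * M.value (pref t) (pref t).loss ((Instance.mk M pref).policyAt L ω τ t)
        - ⨅ π : MarkovPolicy K 𝓢, (Instance.mk M pref).markovLoss π := by
  unfold conditionalRegret Instance.regret
  simp_rw [mul_sub, Finset.sum_sub_distrib, ← Finset.sum_mul, hM.sum_interactionProb, one_mul,
    Finset.mul_sum]
  rw [Finset.sum_comm]

/-- Any fixed pure policy may serve as comparator in place of the minimizer, and the law `q` is the
same for learner and comparator, so losses are compared state by state. -/
theorem sum_gap_le_conditionalRegret (hM : M.HasStateLaw q) (pref : Fin T → Preference K 𝓢)
    (L : Learner H K 𝓢 Ω) (ω : Ω) (u : 𝓢 → Fin K) :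
    ∑ h, ∑ s, q h s * ∑ t, expectedActionMean M pref L ω t h s
        (fun a => (pref t).loss s a - (pref t).loss s (u s, u s))
      ≤ conditionalRegret ⟨M, pref⟩ L ω := by
  rw [hM.conditionalRegret_eq]
  refine le_trans (le_of_eq ?_) (sub_le_sub_left (hM.iInf_markovLoss_le pref u) _)
  simp_rw [hM.sum_interactionProb_mul_value, ← Finset.sum_sub_distrib, Finset.mul_sum,
    expectedActionMean_sub, hM.expectedActionMean_const, mul_sub]
  conv_rhs => rw [Finset.sum_comm]
  exact Finset.sum_congr rfl fun h _ => Finset.sum_comm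

/-- Values lie in `[0, H]`, so the learner's loss is bounded. Integrability lets the average over
best arms pass through the expectation over the learner's randomness. -/
theorem integrable_conditionalRegret (hM : M.HasStateLaw q) (hK : K ≠ 0)
    (pref : Fin T → Preference K 𝓢) (L : Learner H K 𝓢 Ω) (μ : Measure Ω) [IsFiniteMeasure μ] :
    Integrable (fun ω => conditionalRegret ⟨M, pref⟩ L ω) μ := by
  have hpol : ∀ t past h hist s a, Measurable fun ω => L.policy M t past ω h hist s a :=
    fun t past h hist s a => (measurable_pi_apply a).comp
      (measurable_subtype_coe.comp (L.measurable_policy M t past h hist s))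
  have htraj : ∀ (p : Preference K 𝓢) t past x,
      Measurable fun ω => M.trajectoryProb p (L.policy M t past ω) x := fun p t past x =>
    Finset.measurable_prod _ fun h _ => ((hpol _ _ _ _ _ _).const_mul _).mul_const _
  have hprob : ∀ τ, Measurable fun ω => (Instance.mk M pref).interactionProb L ω τ := fun τ =>
    Finset.measurable_prod _ fun t _ => htraj _ _ _ _
  have hval : ∀ τ t, Measurable fun ω =>
      M.value (pref t) (pref t).loss ((Instance.mk M pref).policyAt L ω τ t) := fun τ t =>
    Finset.measurable_sum _ fun x _ => (htraj _ _ _ _).mul_const _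
  refine Integrable.congr (f := fun ω => _) ?_
    (Filter.Eventually.of_forall fun ω => (hM.conditionalRegret_eq pref L ω).symm)
  refine Integrable.sub (integrable_finsetSum _ fun t _ => ?_) (integrable_const _)
  refine Integrable.of_bound (C := (H : ℝ)) (Finset.measurable_sum _ fun τ _ =>
    (hprob τ).mul (hval τ t)).aestronglyMeasurable (Filter.Eventually.of_forall fun ω => ?_)
  rw [Real.norm_of_nonneg (Finset.sum_nonneg fun τ _ =>
    mul_nonneg (interactionProb_nonneg _ _ _ _) (value_nonneg _ _ _))]
  calc _ ≤ ∑ τ, (Instance.mk M pref).interactionProb L ω τ * (H : ℝ) :=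
        Finset.sum_le_sum fun τ _ => mul_le_mul_of_nonneg_left (hM.value_le hK _ _)
          (interactionProb_nonneg _ _ _ _)
    _ = H := by rw [← Finset.sum_mul, hM.sum_interactionProb, one_mul]

end LayeredMDP.HasStateLaw

end Regret

/-! ### The lower bound averaged over the best arms -/

section HardInstances

variable {H K T : ℕ} {𝓢 : Type} [Fintype 𝓢] {Ω : Type*} [MeasurableSpace Ω]
  {M : LayeredMDP H K 𝓢} {q : Fin H → 𝓢 → ℝ} {ε : ℝ} (h₀ : 0 ≤ ε) (h₁ : ε ≤ 1 / 8)

/-- The loss of a pair of arms in excess of the best one. -/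
def gap (θ : 𝓢 → Fin K) (s : 𝓢) (a : Action K) : ℝ :=
  (hardPreference h₀ h₁ θ).loss s a
    - (hardPreference h₀ h₁ θ).loss s (bestArm (θ s), bestArm (θ s))

/-- The total expected excess loss in step `h` and state `s`, not weighted by the probability of
visiting that state. -/
def totalGap (M : LayeredMDP H K 𝓢) (T : ℕ) (L : Learner H K 𝓢 Ω) (ω : Ω) (h : Fin H) (s : 𝓢)
    (θ : 𝓢 → Fin K) : ℝ :=
  ∑ t : Fin T, expectedActionMean M (fun _ => hardPreference h₀ h₁ θ) L ω t h s (gap h₀ h₁ θ s)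

theorem totalGap_nonneg (hK : 5 ≤ K) (L : Learner H K 𝓢 Ω) (ω : Ω) (h : Fin H) (s : 𝓢)
    (θ : 𝓢 → Fin K) : 0 ≤ totalGap h₀ h₁ M T L ω h s θ :=
  Finset.sum_nonneg fun _ _ => expectedActionMean_nonneg _ _ _ _ _ _ _ fun a =>
    (by linarith [badIndicator_nonneg a] : 0 ≤ 1 / 8 * badIndicator a).trans
      (loss_gap_bad h₀ h₁ θ s hK a)

/-- The bonus is given to good arms only, so all bad parameters give one and the same null
environment. -/
theorem hardPreference_update_eq [DecidableEq 𝓢] (θ : 𝓢 → Fin K) (s : 𝓢) {v w : Fin K}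
    (hv : v ∉ goodArms K) (hw : w ∉ goodArms K) :
    hardPreference h₀ h₁ (Function.update θ s v)
      = hardPreference h₀ h₁ (Function.update θ s w) := by
  unfold hardPreference
  congr 1
  funext s' a
  by_cases hs : s' = s
  · subst hs
    have e : ∀ i ∈ goodArms K, i ≠ v ∧ i ≠ w := fun i hi => ⟨fun h => hv (h ▸ hi), fun h => hw (h ▸ hi)⟩
    rw [Function.update_self, Function.update_self]
    unfold hardProb
    split_ifs <;> simp_all
  · rw [Function.update_of_ne hs, Function.update_of_ne hs]

theorem totalGap_update_bad [DecidableEq 𝓢] (hK : 5 ≤ K) (L : Learner H K 𝓢 Ω) (ω : Ω) (h : Fin H)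
    (s : 𝓢) (θ : 𝓢 → Fin K) {v w : Fin K} (hv : v ∉ goodArms K) (hw : w ∉ goodArms K) :
    1 / 8 * ∑ t : Fin T, expectedActionMean M
        (fun _ => hardPreference h₀ h₁ (Function.update θ s w)) L ω t h s badIndicator
      ≤ totalGap h₀ h₁ M T L ω h s (Function.update θ s v) := by
  rw [Finset.mul_sum]
  refine Finset.sum_le_sum fun t _ => ?_
  rw [← expectedActionMean_const_mul, hardPreference_update_eq h₀ h₁ θ s hw hv]
  exact expectedActionMean_mono _ _ _ _ _ _ _ (loss_gap_bad h₀ h₁ _ s hK)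

/-- Missing `v` with the left arm costs `ε / 5`, and how often `v` is played is compared with the
null environment `w`. All quantities on the left refer to the null environment, so they can be
summed over `v`. -/
theorem totalGap_update_good [DecidableEq 𝓢] (hM : M.HasStateLaw q) (hK : 5 ≤ K)
    (L : Learner H K 𝓢 Ω) (ω : Ω) {h : Fin H} {s : 𝓢} (hq : ∀ h', h' ≠ h → q h' s = 0)
    (θ : 𝓢 → Fin K) {v w : Fin K} (hv : v ∈ goodArms K) (hw : w ∉ goodArms K) :
    ε / 5 * ∑ t : Fin T, (3 / 4
        - expectedActionMean M (fun _ => hardPreference h₀ h₁ (Function.update θ s w)) L ω t h s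
            (fun a => if a.1 = v then 1 else 0)
        - 40 * ε ^ 2 * q h s * ∑ t : Fin T, expectedActionMean M
            (fun _ => hardPreference h₀ h₁ (Function.update θ s w)) L ω t h s (informative v))
      ≤ totalGap h₀ h₁ M T L ω h s (Function.update θ s v) := by
  set p₀ := hardPreference h₀ h₁ (Function.update θ s w) with hp₀
  set p₁ := hardPreference h₀ h₁ (Function.update θ s v) with hp₁
  have hprob : ∀ s' a, p₀.pr s' a = hardProb ε (Function.update θ s w s') a := fun _ _ => rfl
  have hprob' : ∀ s' a, p₁.pr s' a = hardProb ε (Function.update θ s v s') a := fun _ _ => rfl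
  have hother : ∀ (t : Fin T) h s', s' ≠ s → q h s' * expectedActionMean M (fun _ => p₀) L ω t h s'
      (fun a => bernoulliKL (p₀.pr s' a) (p₁.pr s' a)) = 0 := fun t h s' hs' => by
    simp_rw [hprob, hprob', Function.update_of_ne hs', bernoulliKL_self]
    rw [hM.expectedActionMean_const, mul_zero]
  have hKL : (∑ t : Fin T, ∑ h, ∑ s, q h s * expectedActionMean M (fun _ => p₀) L ω t h s
      fun a => bernoulliKL (p₀.pr s a) (p₁.pr s a))
      ≤ 10 * ε ^ 2 * q h s * ∑ t : Fin T, expectedActionMean M (fun _ => p₀) L ω t h s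
          (informative v) := by
    rw [Finset.mul_sum]
    refine Finset.sum_le_sum fun t _ => ?_
    -- Only step `h` in state `s` contributes: in other states the environments agree, and `s` is
    -- entered in no other step.
    rw [Finset.sum_eq_single h, Finset.sum_eq_single s]
    · have hmono := expectedActionMean_mono M (fun _ => p₀) L ω t h s
        (f := fun a => bernoulliKL (p₀.pr s a) (p₁.pr s a))
        (g := fun a => 10 * ε ^ 2 * informative v a) fun a => by
          rw [hprob, hprob', Function.update_self, Function.update_self]
          exact bernoulliKL_hardProb_le h₀ h₁ hw a
      rw [expectedActionMean_const_mul] at hmono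
      refine (mul_le_mul_of_nonneg_left hmono (hM.nonneg h s)).trans_eq ?_
      ring
    · intro s' _ hs'
      exact hother t h s' hs'
    · simp
    · intro h' _ hh'
      refine Finset.sum_eq_zero fun s' _ => ?_
      by_cases hs' : s' = s
      · rw [hs', hq h' hh', zero_mul]
      · exact hother t h' s' hs'
    · simp
  rw [Finset.mul_sum]
  refine Finset.sum_le_sum fun t _ => ?_
  -- With `η = 1 / 8` the error is `1 / 4` plus four times the divergence; hence `3 / 4`, and `40 =
  -- 4 * 10`.
  have hchange := hM.expectedActionMean_le_add_kl (p₀ := p₀) (p₁ := p₁)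
    (fun _ _ => hardProb_mem_Ioo h₀ h₁ _ _) (fun _ _ => hardProb_mem_Ioo h₀ h₁ _ _) L ω t h s
    (f := fun a => if a.1 = v then 1 else 0) (fun a => by split_ifs <;> simp)
    (fun a => by split_ifs <;> simp) (η := 1 / 8) (by norm_num)
  have hgap : ε / 5 * (1 - expectedActionMean M (fun _ : Fin T => p₁) L ω t h s
      (fun a => if a.1 = v then 1 else 0))
      ≤ expectedActionMean M (fun _ => p₁) L ω t h s (gap h₀ h₁ (Function.update θ s v) s) := by
    have h2 : (1 : ℝ) = expectedActionMean M (fun _ : Fin T => p₁) L ω t h s fun _ => 1 :=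
      (hM.expectedActionMean_const _ L ω t h s 1).symm
    nth_rw 1 [h2]
    rw [← expectedActionMean_sub, ← expectedActionMean_const_mul]
    refine expectedActionMean_mono _ _ _ _ _ _ _ fun a => ?_
    have h3 := loss_gap_good h₀ h₁ (Function.update θ s v) s hK
      (by rwa [Function.update_self]) a
    rw [Function.update_self] at h3
    refine h3.trans_eq ?_
    rw [gap, Function.update_self]
  refine (mul_le_mul_of_nonneg_left ?_ (by positivity)).trans hgap
  norm_num at hchange
  linarith

/-- The bad values of `v` charge the learner for its exploration `x`, the good ones for its
ignorance. Under `hε` the former pays for all that `x` can save in the latter. -/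
theorem le_sum_totalGap_update [DecidableEq 𝓢] (hM : M.HasStateLaw q) (hK : 5 ≤ K)
    (L : Learner H K 𝓢 Ω) (ω : Ω) {h : Fin H} {s : 𝓢} (hq : ∀ h', h' ≠ h → q h' s = 0)
    (hε : ε ^ 3 * (T * q h s) ≤ K / 160) (θ : 𝓢 → Fin K) :
    K * (ε * T / 25) ≤ ∑ v, totalGap h₀ h₁ M T L ω h s (Function.update θ s v) := by
  have hK0 : (5 : ℝ) ≤ K := by exact_mod_cast hK
  have hg3 : (3 : ℝ) ≤ (goodArms K).card := by
    rw [card_goodArms]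
    exact_mod_cast (by omega : 3 ≤ (K + 1) / 2)
  have hg := half_mul_le (K := K)
  have hb := two_fifths_mul_le hK
  obtain ⟨w, hw⟩ : ∃ w, w ∉ goodArms K := by
    by_contra! hall
    have : (goodArms K) = Finset.univ := Finset.eq_univ_iff_forall.2 hall
    rw [this, Finset.card_univ, Fintype.card_fin] at hb
    linarith
  set p₀ := hardPreference h₀ h₁ (Function.update θ s w) with hp₀
  set x := ∑ t : Fin T, expectedActionMean M (fun _ => p₀) L ω t h s badIndicator with hx
  have hx0 : 0 ≤ x := Finset.sum_nonneg fun t _ =>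
    expectedActionMean_nonneg _ _ _ _ _ _ _ badIndicator_nonneg
  have hbad : (K - (goodArms K).card : ℝ) * (1 / 8 * x)
      ≤ ∑ v ∈ (goodArms K)ᶜ, totalGap h₀ h₁ M T L ω h s (Function.update θ s v) := by
    have hc : (((goodArms K)ᶜ.card : ℕ) : ℝ) = K - (goodArms K).card := by
      rw [Finset.card_compl, Fintype.card_fin, Nat.cast_sub]
      exact (Finset.card_le_univ _).trans_eq (Fintype.card_fin K)
    rw [← hc, ← nsmul_eq_mul]
    exact Finset.card_nsmul_le_sum _ _ _ fun v hv =>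
      totalGap_update_bad h₀ h₁ hK L ω h s θ (Finset.mem_compl.1 hv) hw
  have hgood : ε / 5 * (T * (3 / 4 * (goodArms K).card - 1 - 40 * ε ^ 2 * q h s * x))
      ≤ ∑ v ∈ goodArms K, totalGap h₀ h₁ M T L ω h s (Function.update θ s v) := by
    refine le_trans ?_ (Finset.sum_le_sum fun v hv =>
      totalGap_update_good h₀ h₁ hM hK L ω hq θ hv hw)
    rw [← Finset.mul_sum]
    refine mul_le_mul_of_nonneg_left ?_ (by positivity)
    rw [Finset.sum_comm]
    have hT : (T : ℝ) * (3 / 4 * (goodArms K).card - 1 - 40 * ε ^ 2 * q h s * x)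
        = ∑ t : Fin T, (3 / 4 * (goodArms K).card - 1 - 40 * ε ^ 2 * q h s * x) := by
      rw [Finset.sum_const, Finset.card_univ, Fintype.card_fin, nsmul_eq_mul]
    rw [hT]
    refine Finset.sum_le_sum fun t _ => ?_
    rw [Finset.sum_sub_distrib, Finset.sum_sub_distrib, ← Finset.mul_sum, Finset.sum_comm,
      Finset.sum_const, nsmul_eq_mul]
    have hone : ∑ v ∈ goodArms K, expectedActionMean M (fun _ : Fin T => p₀) L ω t h s
        (fun a => if a.1 = v then 1 else 0) ≤ 1 := by
      rw [sum_expectedActionMean]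
      refine (expectedActionMean_mono _ _ _ _ _ _ _ (g := fun _ => 1) fun a => ?_).trans_eq
        (hM.expectedActionMean_const _ _ _ _ _ _ _)
      rw [Finset.sum_ite_eq]
      split_ifs <;> simp
    have hinf : ∑ t : Fin T, ∑ v ∈ goodArms K, expectedActionMean M (fun _ : Fin T => p₀) L ω t h s
        (informative v) ≤ x := by
      refine Finset.sum_le_sum fun t _ => ?_
      rw [sum_expectedActionMean]
      exact expectedActionMean_mono _ _ _ _ _ _ _ sum_informative_le
    have := mul_le_mul_of_nonneg_left hinf
      (mul_nonneg (by positivity : 0 ≤ 40 * ε ^ 2) (hM.nonneg h s))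
    linarith
  rw [← Finset.sum_add_sum_compl (goodArms K)]
  refine le_trans ?_ (add_le_add hgood hbad)
  -- The information term `8 * ε ^ 3 * T * q h s * x` is at most `K * x / 20`, exactly what the bad
  -- arms guarantee, `2 / 5 * K * (x / 8)`. This fixes the `160`.
  have e1 := mul_le_mul_of_nonneg_right hε (mul_nonneg (by norm_num : (0 : ℝ) ≤ 8) hx0)
  have e2 := mul_le_mul_of_nonneg_right hb (mul_nonneg (by norm_num : (0 : ℝ) ≤ 1 / 8) hx0)
  have e3 : (K : ℝ) / 5 ≤ 3 / 4 * (goodArms K).card - 1 := by linarith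
  have e4 := mul_le_mul_of_nonneg_left e3 (by positivity : 0 ≤ ε / 5 * T)
  nlinarith

theorem le_sum_totalGap [DecidableEq 𝓢] (hM : M.HasStateLaw q) (hK : 5 ≤ K)
    (L : Learner H K 𝓢 Ω) (ω : Ω) {h : Fin H} {s : 𝓢} (hq : ∀ h', h' ≠ h → q h' s = 0)
    (hε : ε ^ 3 * (T * q h s) ≤ K / 160) :
    Fintype.card (𝓢 → Fin K) * (ε * T / 25) ≤ ∑ θ, totalGap h₀ h₁ M T L ω h s θ := by
  have hK0 : (0 : ℝ) < K := by exact_mod_cast (by omega : 0 < K)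
  have hsum := Finset.sum_le_sum fun θ (_ : θ ∈ Finset.univ (α := 𝓢 → Fin K)) =>
    le_sum_totalGap_update (T := T) h₀ h₁ hM hK L ω hq hε θ
  rw [sum_sum_update, Fintype.card_fin, Finset.sum_const, Finset.card_univ, nsmul_eq_mul,
    mul_left_comm] at hsum
  exact le_of_mul_le_mul_left hsum hK0

/-- If the law of the states is balanced in all steps but the first, then some assignment of best
arms is hard for the learner. -/
theorem exists_le_expectedRegret [DecidableEq 𝓢] (hM : M.HasStateLaw q) (hK : 5 ≤ K) (L : Learner H K 𝓢 Ω)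
    (μ : Measure Ω) [IsProbabilityMeasure μ]
    (hq : ∀ (h h' : Fin H) s, q h s ≠ 0 → h' ≠ h → q h' s = 0)
    (hε : ∀ (h : Fin H) s, (h : ℕ) ≠ 0 → ε ^ 3 * (T * q h s) ≤ K / 160) :
    ∃ θ : 𝓢 → Fin K, ((H : ℝ) - 1) * (ε * T / 25)
      ≤ (Instance.mk M fun _ : Fin T => hardPreference h₀ h₁ θ).expectedRegret L μ := by
  have hK0 : K ≠ 0 := by omega
  -- Makes the set of assignments `θ` nonempty, as the final selection requires.
  have : NeZero K := ⟨hK0⟩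
  have hpoint : ∀ ω, Fintype.card (𝓢 → Fin K) * (((H : ℝ) - 1) * (ε * T / 25))
      ≤ ∑ θ : 𝓢 → Fin K,
        conditionalRegret ⟨M, fun _ : Fin T => hardPreference h₀ h₁ θ⟩ L ω := by
    intro ω
    have hreg := Finset.sum_le_sum fun θ (_ : θ ∈ Finset.univ (α := 𝓢 → Fin K)) =>
      hM.sum_gap_le_conditionalRegret (fun _ : Fin T => hardPreference h₀ h₁ θ) L ω
        fun s => bestArm (θ s)
    refine le_trans ?_ hreg
    rw [Finset.sum_comm]
    -- The first step is given up, since `hε` says nothing about it; this is the loss from `H` to `H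
    -- - 1`.
    have hlayer : ∀ h : Fin H, (if (h : ℕ) = 0 then 0
        else Fintype.card (𝓢 → Fin K) * (ε * T / 25))
        ≤ ∑ θ : 𝓢 → Fin K, ∑ s, q h s * totalGap h₀ h₁ M T L ω h s θ := by
      intro h
      split_ifs with h0
      · exact Finset.sum_nonneg fun θ _ => Finset.sum_nonneg fun s _ =>
          mul_nonneg (hM.nonneg h s) (totalGap_nonneg h₀ h₁ hK L ω h s θ)
      · rw [Finset.sum_comm]
        simp_rw [← Finset.mul_sum]
        calc _ = ∑ s, q h s * (Fintype.card (𝓢 → Fin K) * (ε * T / 25)) := by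
              rw [← Finset.sum_mul, hM.sum_eq_one, one_mul]
          _ ≤ _ := Finset.sum_le_sum fun s _ => by
              by_cases hs : q h s = 0
              · simp [hs]
              · exact mul_le_mul_of_nonneg_left
                  (le_sum_totalGap h₀ h₁ hM hK L ω (fun h' hh' => hq h h' s hs hh') (hε h s h0))
                  (hM.nonneg h s)
    refine le_trans ?_ (Finset.sum_le_sum fun h _ => hlayer h)
    have hcount : ∑ h : Fin H, (if (h : ℕ) = 0 then (0 : ℝ)
        else Fintype.card (𝓢 → Fin K) * (ε * T / 25))
        ≥ ((H : ℝ) - 1) * (Fintype.card (𝓢 → Fin K) * (ε * T / 25)) := by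
      cases H with
      | zero =>
        have : 0 ≤ Fintype.card (𝓢 → Fin K) * (ε * T / 25) := by positivity
        rw [Finset.univ_eq_empty, Finset.sum_empty, Nat.cast_zero]
        linarith
      | succ n => simp [Fin.sum_univ_succ]
    linarith
  have hint : ∀ θ : 𝓢 → Fin K, Integrable (fun ω =>
      conditionalRegret ⟨M, fun _ : Fin T => hardPreference h₀ h₁ θ⟩ L ω) μ := fun θ =>
    hM.integrable_conditionalRegret hK0 _ L μ
  have hsum : ∑ _θ : 𝓢 → Fin K, ((H : ℝ) - 1) * (ε * T / 25) ≤ ∑ θ : 𝓢 → Fin K,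
      (Instance.mk M fun _ : Fin T => hardPreference h₀ h₁ θ).expectedRegret L μ := by
    change _ ≤ ∑ θ : 𝓢 → Fin K, ∫ ω,
      conditionalRegret ⟨M, fun _ : Fin T => hardPreference h₀ h₁ θ⟩ L ω ∂μ
    rw [← integral_finsetSum _ fun θ _ => hint θ, Finset.sum_const, Finset.card_univ, nsmul_eq_mul]
    have := integral_mono (integrable_const _) (integrable_finsetSum _ fun θ _ => hint θ) hpoint
    simpa using this
  obtain ⟨θ, -, hθ⟩ := Finset.exists_le_of_sum_le Finset.univ_nonempty hsum
  exact ⟨θ, hθ⟩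

end HardInstances

end PbMDP

end

/-! ### Choice of the bonus and the constant -/

theorem theorem2 :
    ∃ c : ℝ, 0 < c ∧
      ∀ H K S T : ℕ, 3 ≤ H → 5 ≤ K → H + 1 ≤ S → S * K ≤ H * T →
        ∀ (Ω : Type*) [MeasurableSpace Ω] (μ : Measure Ω) [IsProbabilityMeasure μ]
          (L : PbMDP.Learner H K (Fin S) Ω),
          ∃ I : PbMDP.Instance H K T (Fin S),
            c * (((H : ℝ) ^ 2 * (S : ℝ) * (K : ℝ)) ^ ((1 : ℝ) / 3) * (T : ℝ) ^ ((2 : ℝ) / 3))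
              ≤ I.expectedRegret L μ := by
  refine ⟨1 / 400, by norm_num, fun H K S T hH hK hS hT Ω _ μ _ L => ?_⟩
  have hH2 : 2 ≤ H := by omega
  have hH0 : (3 : ℝ) ≤ H := by exact_mod_cast hH
  have hK0 : (0 : ℝ) < K := by exact_mod_cast (by omega : 0 < K)
  have hS0 : (0 : ℝ) < S := by exact_mod_cast (by omega : 0 < S)
  have hTR : (S : ℝ) * K ≤ H * T := by exact_mod_cast hT
  have hT0 : (0 : ℝ) < T := by
    have h1 : 0 < (H : ℝ) * T := (mul_pos hS0 hK0).trans_le hTR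
    exact pos_of_mul_pos_right h1 (by linarith)
  have hHT : (0 : ℝ) < H * T := by positivity
  -- The target rate is `H * T * u`, and `S * K ≤ H * T` means `u ≤ 1`.
  set u : ℝ := ((S : ℝ) * K / (H * T)) ^ ((1 : ℝ) / 3) with hu
  have hu0 : 0 ≤ u := by positivity
  have hcube : ∀ x : ℝ, 0 ≤ x → (x ^ ((1 : ℝ) / 3)) ^ 3 = x := fun x hx => by
    rw [← Real.rpow_natCast, ← Real.rpow_mul hx]
    norm_num
  have hu3 : u ^ 3 = (S : ℝ) * K / (H * T) := hcube _ (by positivity)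
  have hu1 : u ≤ 1 := Real.rpow_le_one (by positivity) ((div_le_one hHT).2 hTR) (by norm_num)
  have hscale : ((H : ℝ) ^ 2 * S * K) ^ ((1 : ℝ) / 3) * (T : ℝ) ^ ((2 : ℝ) / 3) = H * T * u := by
    set b : ℝ := (T : ℝ) ^ ((1 : ℝ) / 3) with hb
    have hb0 : 0 ≤ b := by positivity
    have hb3 : b ^ 3 = T := hcube _ hT0.le
    have hb2 : (T : ℝ) ^ ((2 : ℝ) / 3) = b ^ 2 := by
      rw [hb, ← Real.rpow_natCast, ← Real.rpow_mul hT0.le]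
      norm_num
    have ha : ((H : ℝ) ^ 2 * S * K) ^ ((1 : ℝ) / 3) = H * u * b := by
      refine (pow_left_inj₀ (by positivity) (by positivity) three_ne_zero).1 ?_
      rw [hcube _ (by positivity), mul_pow, mul_pow, hu3, hb3]
      field_simp
    rw [ha, hb2, ← hb3]
    ring
  -- The bonus is `ε = u / 9`. Layers of size at least `S / (4 * H)` give `ε ^ 3 * T * q ≤ 4 * K /
  -- 729 ≤ K / 160`.
  have h₀ : 0 ≤ u / 9 := by positivity
  have h₁ : u / 9 ≤ 1 / 8 := by linarith
  have hM := PbMDP.uniformMDP_hasStateLaw (K := K) (PbMDP.balancedLayer H S hH2)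
    (PbMDP.balancedLayer_surjective hH2 hS) _ _ (PbMDP.balancedLayer_eq_zero_iff hH2 hS)
    (PbMDP.balancedLayer_eq_last_iff hH2 hS)
  have hq : ∀ (h h' : Fin H) (s : Fin S),
      PbMDP.layerWeight (PbMDP.balancedLayer H S hH2) h.castSucc s ≠ 0 → h' ≠ h →
      PbMDP.layerWeight (PbMDP.balancedLayer H S hH2) h'.castSucc s = 0 := by
    intro h h' s hs hne
    refine if_neg fun hl => hs (if_neg fun hl' => hne ?_)
    exact Fin.castSucc_injective H (hl.symm.trans hl')
  have hε : ∀ (h : Fin H) (s : Fin S), (h : ℕ) ≠ 0 → (u / 9) ^ 3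
      * (T * PbMDP.layerWeight (PbMDP.balancedLayer H S hH2) h.castSucc s) ≤ K / 160 := by
    intro h s hh
    unfold PbMDP.layerWeight
    split_ifs with hl
    · have hn := PbMDP.le_mul_card_layerStates hH2 hS h.castSucc
        (fun h0 => hh (congrArg Fin.val h0)) (Fin.castSucc_lt_last h).ne
      set n := (PbMDP.layerStates (PbMDP.balancedLayer H S hH2) h.castSucc).card
      have hnR : (S : ℝ) ≤ 4 * H * n := by exact_mod_cast hn
      have hn0 : (0 : ℝ) < n := by
        have : 0 < 4 * (H : ℝ) * n := hS0.trans_le hnR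
        exact pos_of_mul_pos_right this (by positivity)
      have e : (u / 9) ^ 3 * (T * (1 / (n : ℝ))) = S * K / (729 * H * n) := by
        rw [div_pow, hu3]
        field_simp
        norm_num
      rw [e, div_le_iff₀ (by positivity)]
      nlinarith [mul_le_mul_of_nonneg_left hnR hK0.le]
    · simp only [mul_zero]
      positivity
  obtain ⟨θ, hθ⟩ := PbMDP.exists_le_expectedRegret (T := T) h₀ h₁ hM hK L μ hq hε
  refine ⟨_, le_trans ?_ hθ⟩
  rw [hscale]
  -- Since `H - 1 ≥ 2 / 3 * H`, the bound `(H - 1) * T * u / 225` is at least `H * T * u / 400`.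
  have : 0 ≤ (T : ℝ) * u := by positivity
  nlinarith
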